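/- All graphs are finite and simple. A set $S$ of edges of a graph $G$ is a *cyclic edge cut* if two different components of $G-S$ contain cycles; the *cyclic edge-connectivity* of $G$ is the least size of a cyclic edge cut. A *snark* is a cubic graph with cyclic edge-connectivity at least $4$, edge-chromatic number $4$ and girth at least $5$. A *$2$-factor* is a $2$-regular spanning subgraph; it is *odd* if all its cycles have odd length, and a graph is *odd $2$-factored* if all its $2$-factors are odd. An edge $xy$ of a snark $L$ is a *bold-edge* if (i) all $2$-factors of $L-x$ and of $L-y$ are odd, (ii) all $2$-factors of $L$ containing $xy$ are odd, and (iii) all $2$-factors of $L$ avoiding $xy$ are odd. Two independent edges $ab$, $cd$ of a snark $R$ form a *gadget-pair* if (i) no $2$-factor of $R$ avoids both; (ii) all $2$-factors of $R$ containing exactly one of them are odd; (iii) all $2$-factors of $R$ containing both are odd and contain $ab$ and $cd$ in different cycles; (iv) in every $2$-factor of $(R-\{ab,cd\})\cup\{ac,ad,bc,bd\}$ that contains exactly one edge of $\{ac,ad,bc,bd\}$, the cycle through that edge is even and all other cycles are odd. A *bold-gadget dot product* of snarks $L$ and $R$ is obtained by choosing a bold-edge $xy$ of $L$, with $N(x)\setminus\{y\}=\{r,s\}$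 and $N(y)\setminus\{x\}=\{t,u\}$, and a gadget-pair $ab$, $cd$ of $R$ (with any naming of these vertices), and forming from the disjoint union of $L-\{x,y\}$ and $R-\{ab,cd\}$ a new graph by adding the edges $ra$, $sb$, $tc$, $ud$. For odd $t\ge 5$ the *Flower snark* $J(t)$ has vertices $h_i,u_i,v_i,w_i$ ($1\le i\le t$) and edges $h_iu_i$, $h_iv_i$, $h_iw_i$ ($1\le i\le t$), $u_ju_{j+1}$, $v_jv_{j+1}$, $w_jw_{j+1}$ ($1\le j\le t-1$), and $u_tv_1$, $v_tu_1$, $w_tw_1$. Let $P_{18}$, $P_{26}$, $P_{34}$ be the following graphs on $\{1,\dots,n\}$ with $n=18,26,34$; they are, respectively, a bold-gadget dot product $L\cdot R$ with $R$ the Petersen graph and $L$ the Petersen graph, $P_{18}$, $P_{26}$. For an integer $k$ let $B_k$ denote the graph on $k+1,\dots,k+10$ with edges (writing $i$ for $k+i$) $\{1,2\},\{1,6\},\{2,3\},\{2,4\},\{3,10\},\{4,5\},\{4,8\},\{5,6\},\{5,10\},\{6,7\},\{7,8\},\{8,9\},\{9,10\}$. * $P_{18}$: the edges of $B_8$, the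 edges $\{1,2\},\{1,4\},\{2,3\},\{2,6\},\{3,8\},\{4,5\},\{4,8\},\{5,6\},\{6,7\},\{7,8\}$, and $\{1,9\},\{3,11\},\{5,15\},\{7,17\}$. * $P_{26}$: the edges of $B_6$ and $B_{16}$, the edges $\{1,2\},\{2,3\},\{2,5\},\{4,5\},\{5,6\}$, and $\{1,7\},\{3,13\},\{4,9\},\{6,15\},\{1,19\},\{3,17\},\{4,23\},\{6,25\}$. * $P_{34}$: the edges of $B_4$ and $B_{14}$, the edges $\{25,26\},\{25,34\},\{26,27\},\{26,28\},\{27,30\},\{28,29\},\{28,32\},\{29,30\},\{29,34\},\{30,31\},\{31,32\},\{32,33\},\{33,34\}$, and $\{1,5\},\{2,7\},\{3,13\},\{4,11\},\{1,17\},\{2,21\},\{3,23\},\{4,15\},\{1,25\},\{2,33\},\{3,27\},\{4,31\}$. **Theorem.** Let $G$ be an odd $2$-factored snark of cyclic edge-connectivity four that can be obtained from the Petersen graph and the Flower snarks $J(t)$ ($t\ge5$ odd) by iterating the bold-gadget dot product. Then $G$ is isomorphic to $P_{18}$, $P_{26}$ or $P_{34}$. -/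

import Mathlib

namespace BoldGadget

universe u

/-! ### Cyclic edge-connectivity and snarks -/

/-- Every vertex has exactly three neighbours. -/
def IsCubic {V : Type u} (G : SimpleGraph V) : Prop :=
  ∀ v, (G.neighborSet v).ncard = 3

/-- A set `S` of edges of `G` is a cycle-separating edge cut: after deleting `S`, there are two
cycles that lie in different connected components. -/
def IsCyclicEdgeCut {V : Type u} (G : SimpleGraph V) (S : Set (Sym2 V)) : Prop :=
  S ⊆ G.edgeSet ∧
    ∃ (u v : V) (p : (G.deleteEdges S).Walk u u) (q : (G.deleteEdges S).Walk v v),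
      p.IsCycle ∧ q.IsCycle ∧ ¬ (G.deleteEdges S).Reachable u v

/-- The cyclic edge-connectivity: the least size of a cycle-separating edge cut
(`⊤` if there is none). -/
noncomputable def cyclicEdgeConnectivity {V : Type u} (G : SimpleGraph V) : ℕ∞ :=
  ⨅ (S : Set (Sym2 V)) (_ : IsCyclicEdgeCut G S), S.encard

/-- A snark: a cyclically 4-edge-connected cubic graph with edge-chromatic number four and girth
at least five. (The edge-chromatic number is the chromatic number of the line graph.) -/
structure IsSnark {V : Type u} (G : SimpleGraph V) : Prop where
  cubic : IsCubic G
  cyclically_four_edge_connected : 4 ≤ cyclicEdgeConnectivity G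
  chromatic_index : G.lineGraph.chromaticNumber = 4
  girth : 5 ≤ G.egirth

/-! ### 2-factors -/

/-- `F` is (the edge set of) a 2-factor of `G`: a 2-regular spanning subgraph. -/
def IsTwoFactor {V : Type u} (G F : SimpleGraph V) : Prop :=
  F ≤ G ∧ ∀ v, (F.neighborSet v).ncard = 2

/-- All cycles of `F` have odd length. -/
def AllCyclesOdd {V : Type u} (F : SimpleGraph V) : Prop :=
  ∀ (v : V) (p : F.Walk v v), p.IsCycle → Odd p.length

/-- `G` is odd 2-factored: in every 2-factor of `G` every cycle is odd. -/
def IsOddTwoFactored {V : Type u} (G : SimpleGraph V) : Prop :=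
  ∀ F, IsTwoFactor G F → AllCyclesOdd F

/-! ### Bold-edges, gadget-pairs and the dot product -/

/-- The edge `xy` of `L` is a bold-edge. `L.induce {x}ᶜ` is the graph `L - x`. -/
structure IsBoldEdge {V : Type u} (L : SimpleGraph V) (x y : V) : Prop where
  adj : L.Adj x y
  odd_delete_left : IsOddTwoFactored (L.induce {x}ᶜ)
  odd_delete_right : IsOddTwoFactored (L.induce {y}ᶜ)
  odd_containing : ∀ F, IsTwoFactor L F → F.Adj x y → AllCyclesOdd F
  odd_avoiding : ∀ F, IsTwoFactor L F → ¬ F.Adj x y → AllCyclesOdd F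

/-- The four possible edges between `{a, b}` and `{c, d}`. -/
def crossEdges {V : Type u} (a b c d : V) : Set (Sym2 V) :=
  {s(a, c), s(a, d), s(b, c), s(b, d)}

/-- The graph `(R - {ab, cd}) ∪ {ac, ad, bc, bd}`. -/
def switchGraph {V : Type u} (R : SimpleGraph V) (a b c d : V) : SimpleGraph V :=
  R.deleteEdges {s(a, b), s(c, d)} ⊔ SimpleGraph.fromEdgeSet (crossEdges a b c d)

/-- The independent edges `ab` and `cd` of `R` form a gadget-pair. -/
structure IsGadgetPair {V : Type u} (R : SimpleGraph V) (a b c d : V) : Prop where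
  adj_left : R.Adj a b
  adj_right : R.Adj c d
  independent : a ≠ c ∧ a ≠ d ∧ b ≠ c ∧ b ≠ d
  /-- No 2-factor avoids both edges. -/
  not_avoiding : ∀ F, IsTwoFactor R F → F.Adj a b ∨ F.Adj c d
  /-- 2-factors containing exactly one of the two edges are odd. -/
  odd_one : ∀ F, IsTwoFactor R F → Xor (F.Adj a b) (F.Adj c d) → AllCyclesOdd F
  /-- 2-factors containing both edges are odd, -/
  odd_both : ∀ F, IsTwoFactor R F → F.Adj a b → F.Adj c d → AllCyclesOdd F
  /-- and the two edges lie in different cycles of such a 2-factor. -/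
  different_cycles : ∀ F, IsTwoFactor R F → F.Adj a b → F.Adj c d →
    ∀ (v : V) (p : F.Walk v v), p.IsCycle → ¬ (s(a, b) ∈ p.edges ∧ s(c, d) ∈ p.edges)
  /-- If a 2-factor of `(R - {ab, cd}) ∪ {ac, ad, bc, bd}` contains exactly one edge `e` of
  `{ac, ad, bc, bd}`, then its cycle through `e` is even and all its other cycles are odd. -/
  switch : ∀ F, IsTwoFactor (switchGraph R a b c d) F →
    ∀ e, F.edgeSet ∩ crossEdges a b c d = {e} →
      ∀ (v : V) (p : F.Walk v v), p.IsCycle →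
        (e ∈ p.edges → Even p.length) ∧ (e ∉ p.edges → Odd p.length)

/-- The dot product: delete the vertices `x`, `y` from `L` and the edges `ab`, `cd` from `R`, and
add the edges `ra`, `sb`, `tc`, `ud`. Here `{r, s}` and `{t, u}` are meant to be the remaining
neighbours of `x` and of `y`; every way to join `{r, s}` to one of the removed edges and `{t, u}`
to the other arises from some naming of the vertices. -/
def snarkDotProduct {V W : Type u} (L : SimpleGraph V) (x y r s t u : V)
    (R : SimpleGraph W) (a b c d : W) : SimpleGraph ({v : V // v ≠ x ∧ v ≠ y} ⊕ W) :=
  SimpleGraph.fromRel fun p q =>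
    match p, q with
    | .inl v, .inl v' => L.Adj v v'
    | .inr w, .inr w' => R.Adj w w' ∧ s(w, w') ≠ s(a, b) ∧ s(w, w') ≠ s(c, d)
    | .inl v, .inr w =>
        (v.1 = r ∧ w = a) ∨ (v.1 = s ∧ w = b) ∨ (v.1 = t ∧ w = c) ∨ (v.1 = u ∧ w = d)
    | .inr _, .inl _ => False

/-! ### The Petersen graph and the flower snarks -/

/-- The graph with vertices labelled `1, …, n` (the label of `i : Fin n` is `i + 1`) and the
listed edges. -/
def graphOfEdges (n : ℕ) (l : List (ℕ × ℕ)) : SimpleGraph (Fin n) :=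
  SimpleGraph.fromRel fun i j => (i.val + 1, j.val + 1) ∈ l

/-- The Petersen graph: pentagon `1 2 3 4 5`, pentagram `6 8 10 7 9`, and five spokes. -/
def petersen : SimpleGraph (Fin 10) :=
  graphOfEdges 10
   [(1, 2), (1, 5), (1, 6), (2, 3), (2, 7), (3, 4), (3, 8), (4, 5), (4, 9), (5, 10),
    (6, 8), (6, 9), (7, 9), (7, 10), (8, 10)]

/-- Vertices `hᵢ, uᵢ, vᵢ, wᵢ` of the flower snark; indices run through `0, …, t - 1`. -/
inductive FlowerVertex (t : ℕ) : Type
  | h (i : Fin t)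
  | u (i : Fin t)
  | v (i : Fin t)
  | w (i : Fin t)

/-- The flower snark `J(t)` (for odd `t ≥ 5`): hubs `hᵢ` joined to `uᵢ, vᵢ, wᵢ`; paths
`u₁ … u_t`, `v₁ … v_t`, `w₁ … w_t`; and the edges `u_t v₁`, `v_t u₁`, `w_t w₁`. -/
def flower (t : ℕ) : SimpleGraph (FlowerVertex t) :=
  SimpleGraph.fromRel fun p q =>
    match p, q with
    | .h i, .u j => i = j
    | .h i, .v j => i = j
    | .h i, .w j => i = j
    | .u i, .u j => i.val + 1 = j.val
    | .v i, .v j => i.val + 1 = j.val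
    | .w i, .w j => i.val + 1 = j.val ∨ (i.val + 1 = t ∧ j.val = 0)
    | .u i, .v j => i.val + 1 = t ∧ j.val = 0
    | .v i, .u j => i.val + 1 = t ∧ j.val = 0
    | _, _ => False

/-! ### Graphs obtained by iterating the construction -/

/-- The graphs that can be constructed (up to isomorphism) from the Petersen graph and the flower
snarks `J(t)`, `t ≥ 5` odd, by iterating the bold-gadget dot product, i.e. the dot product `L · R`
of snarks `L` and `R` formed at a bold-edge `xy` of `L` and a gadget-pair `ab, cd` of `R`. -/
inductive BoldGadgetConstructible : ∀ {V : Type u}, SimpleGraph V → Prop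
  | petersen {V : Type u} (G : SimpleGraph V) (e : G ≃g petersen) : BoldGadgetConstructible G
  | flower {V : Type u} (G : SimpleGraph V) (t : ℕ) (ht : 5 ≤ t) (hodd : Odd t)
      (e : G ≃g flower t) : BoldGadgetConstructible G
  | dot {V W X : Type u} (L : SimpleGraph V) (R : SimpleGraph W) (G : SimpleGraph X)
      (x y r s t u : V) (a b c d : W)
      (hL : BoldGadgetConstructible L) (hR : BoldGadgetConstructible R)
      (snarkL : IsSnark L) (snarkR : IsSnark R)
      (bold : IsBoldEdge L x y) (gadget : IsGadgetPair R a b c d)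
      (hx : L.neighborSet x \ {y} = {r, s}) (hy : L.neighborSet y \ {x} = {t, u})
      (e : G ≃g snarkDotProduct L x y r s t u R a b c d) : BoldGadgetConstructible G

/-! ### The snarks of order 18, 26 and 34 -/

/-- The snark `P₁₈` (the second Blanuša snark): the dot product of two Petersen graphs at a
bold-edge and a gadget-pair. -/
def P18 : SimpleGraph (Fin 18) :=
  graphOfEdges 18
   [(1, 2), (1, 4), (1, 9), (2, 3), (2, 6), (3, 8), (3, 11), (4, 5), (4, 8), (5, 6),
    (5, 15), (6, 7), (7, 8), (7, 17), (9, 10), (9, 14), (10, 11), (10, 12), (11, 18),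
    (12, 13), (12, 16), (13, 14), (13, 18), (14, 15), (15, 16), (16, 17), (17, 18)]

/-- The snark `P₂₆`: the dot product of `P₁₈` and the Petersen graph at a bold-edge and a
gadget-pair. -/
def P26 : SimpleGraph (Fin 26) :=
  graphOfEdges 26
   [(1, 2), (1, 7), (1, 19), (2, 3), (2, 5), (3, 13), (3, 17), (4, 5), (4, 9), (4, 23),
    (5, 6), (6, 15), (6, 25), (7, 8), (7, 12), (8, 9), (8, 10), (9, 16), (10, 11),
    (10, 14), (11, 12), (11, 16), (12, 13), (13, 14), (14, 15), (15, 16), (17, 18),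
    (17, 22), (18, 19), (18, 20), (19, 26), (20, 21), (20, 24), (21, 22), (21, 26),
    (22, 23), (23, 24), (24, 25), (25, 26)]

/-- The snark `P₃₄`: the dot product of `P₂₆` and the Petersen graph at a bold-edge and a
gadget-pair. -/
def P34 : SimpleGraph (Fin 34) :=
  graphOfEdges 34
   [(1, 5), (1, 17), (1, 25), (2, 7), (2, 21), (2, 33), (3, 13), (3, 23), (3, 27), (4, 11),
    (4, 15), (4, 31), (5, 6), (5, 10), (6, 7), (6, 8), (7, 14), (8, 9), (8, 12), (9, 10),
    (9, 14), (10, 11), (11, 12), (12, 13), (13, 14), (15, 16), (15, 20), (16, 17),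
    (16, 18), (17, 24), (18, 19), (18, 22), (19, 20), (19, 24), (20, 21), (21, 22),
    (22, 23), (23, 24), (25, 26), (25, 34), (26, 27), (26, 28), (27, 30), (28, 29),
    (28, 32), (29, 30), (29, 34), (30, 31), (31, 32), (32, 33), (33, 34)]

end BoldGadget

/-!
The three target graphs are reached because hardly any dot product can be formed. In a cubic graph
a 2-factor is the complement of a perfect matching, so a matching that covers everything outside a
suitable set of vertices yields a 2-factor of the kind forbidden to gadget-pairs or bold-edges.
Among the Petersen graph, the flower snarks, `P18`, `P26` and `P34`, only the Petersen graph has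
gadget-pairs, and these are all equivalent under its automorphisms; neither the flower snarks nor
`P34` have bold-edges. So only the dot products of the Petersen graph, `P18` and `P26` with the
Petersen graph occur, and these are `P18`, `P26` and `P34` whichever bold-edge is chosen. The
Petersen graph and the flower snarks are then excluded because their cyclic edge-connectivity is at
least five.
-/

namespace BoldGadget

open SimpleGraph

universe u v

section TwoFactors

variable {V W : Type*} {G : SimpleGraph V} {H : SimpleGraph W}

/-- The involution `m` is a perfect matching of the subgraph of `G` induced by `S`. The values of
`m` outside `S` are arbitrary. -/
def IsMatchingOn (G : SimpleGraph V) (m : V → V) (S : Set V) : Prop :=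
  ∀ v ∈ S, G.Adj v (m v) ∧ m v ∈ S ∧ m (m v) = v

/-- The graph obtained from `G` by deleting all edges from `v` to `m v`. -/
def unmatched (G : SimpleGraph V) (m : V → V) : SimpleGraph V where
  Adj v w := G.Adj v w ∧ m v ≠ w ∧ m w ≠ v
  symm := ⟨fun _ _ h => ⟨h.1.symm, h.2.2, h.2.1⟩⟩
  loopless := ⟨fun _ h => h.1.ne rfl⟩

lemma unmatched_le (m : V → V) : unmatched G m ≤ G := fun _ _ h => h.1

lemma neighborSet_unmatched (m : V → V) (v : V) :
    (unmatched G m).neighborSet v = G.neighborSet v \ ({m v} ∪ m ⁻¹' {v}) := by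
  ext w
  simp [unmatched, eq_comm]

lemma IsCubic.ncard_neighborSet_sdiff (hG : IsCubic G) {v : V} {S : Set V}
    (hS : S ⊆ G.neighborSet v) : (G.neighborSet v \ S).ncard = 3 - S.ncard := by
  have hfin : (G.neighborSet v).Finite := Set.finite_of_ncard_ne_zero (by simp [hG v])
  rw [Set.ncard_sdiff hS (hfin.subset hS), hG v]

lemma IsMatchingOn.preimage_eq {m : V → V} {S : Set V} (hm : IsMatchingOn G m S) {v : V}
    (hv : v ∈ S) : m ⁻¹' {v} ∩ S = {m v} := by
  ext w
  simp only [Set.mem_inter_iff, Set.mem_preimage, Set.mem_singleton_iff]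
  constructor
  · rintro ⟨rfl, hw⟩
    exact (hm w hw).2.2.symm
  · rintro rfl
    exact ⟨(hm v hv).2.2, (hm v hv).2.1⟩

lemma IsMatchingOn.of_sdiff_pair {m : V → V} {S : Set V} {v w : V}
    (hm : IsMatchingOn G m (S \ {v, w})) (hadj : G.Adj v w) (hv : v ∈ S) (hw : w ∈ S)
    (hmv : m v = w) (hmw : m w = v) : IsMatchingOn G m S := by
  intro z hz
  by_cases hzv : z = v
  · subst hzv
    exact ⟨hmv ▸ hadj, hmv ▸ hw, by rw [hmv, hmw]⟩
  by_cases hzw : z = w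
  · subst hzw
    exact ⟨hmw ▸ hadj.symm, hmw ▸ hv, by rw [hmw, hmv]⟩
  · obtain ⟨h₁, h₂, h₃⟩ := hm z ⟨hz, by simp [hzv, hzw]⟩
    exact ⟨h₁, h₂.1, h₃⟩

lemma IsCubic.ncard_neighborSet_unmatched (hG : IsCubic G) {m : V → V} {v : V}
    (hadj : G.Adj v (m v)) (hpre : m ⁻¹' {v} ⊆ {m v}) :
    ((unmatched G m).neighborSet v).ncard = 2 := by
  rw [neighborSet_unmatched, Set.union_eq_left.2 hpre,
    hG.ncard_neighborSet_sdiff (by simpa using hadj), Set.ncard_singleton]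

lemma IsMatchingOn.isTwoFactor_unmatched (hG : IsCubic G) {m : V → V}
    (hm : IsMatchingOn G m Set.univ) : IsTwoFactor G (unmatched G m) := by
  refine ⟨unmatched_le m, fun v => hG.ncard_neighborSet_unmatched (hm v trivial).1 ?_⟩
  simpa using (hm.preimage_eq (Set.mem_univ v)).le

lemma IsGadgetPair.not_isMatchingOn (hG : IsCubic G) {m : V → V} {a c : V}
    (h : IsGadgetPair G a (m a) c (m c)) : ¬ IsMatchingOn G m Set.univ := by
  intro hm
  rcases h.not_avoiding _ (hm.isTwoFactor_unmatched hG) with h | h <;> exact h.2.1 rfl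

lemma IsCubic.not_isOddTwoFactored_induce (hG : IsCubic G) {m : V → V} {x v : V}
    (hm : IsMatchingOn G m {w | w ≠ x ∧ ¬ G.Adj x w}) (hx : ∀ w, G.Adj x w → m w = x)
    {p : (unmatched G m).Walk v v} (hp : p.IsCycle) (heven : Even p.length)
    (hxp : x ∉ p.support) : ¬ IsOddTwoFactored (G.induce {x}ᶜ) := by
  intro hodd
  have hF : IsTwoFactor (G.induce {x}ᶜ) ((unmatched G m).induce {x}ᶜ) := by
    refine ⟨fun _ _ h => h.1, fun ⟨v, (hv : v ≠ x)⟩ => ?_⟩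
    have hnbr : Subtype.val '' ((unmatched G m).induce {x}ᶜ).neighborSet ⟨v, hv⟩ =
        G.neighborSet v \ {m v} := by
      ext w
      simp only [Set.mem_image, mem_neighborSet, comap_adj, Function.Embedding.subtype_apply,
        Subtype.exists, Set.mem_compl_iff, Set.mem_singleton_iff, exists_and_right,
        exists_eq_right, Set.mem_sdiff, unmatched]
      refine ⟨fun ⟨⟨_, h⟩, hne, _⟩ => ⟨h, Ne.symm hne⟩, fun ⟨h, hne⟩ => ?_⟩
      have hwx : w ≠ x := by
        rintro rfl
        exact hne (hx v h.symm).symm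
      refine ⟨⟨hwx, h⟩, Ne.symm hne, fun hwv => hne ?_⟩
      have hw : ¬ G.Adj x w := fun h => hv (hwv.symm.trans (hx w h))
      rw [← hwv, (hm w ⟨hwx, hw⟩).2.2]
    have hadj : G.Adj v (m v) := by
      by_cases h : G.Adj x v
      · rw [hx v h]; exact h.symm
      · exact (hm v ⟨hv, h⟩).1
    rw [← Set.ncard_image_of_injective _ Subtype.val_injective, hnbr,
      hG.ncard_neighborSet_sdiff (by simpa using hadj), Set.ncard_singleton]
  have hsupp : ∀ w ∈ p.support, w ∈ ({x}ᶜ : Set V) := fun w hw => by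
    rintro rfl; exact hxp hw
  have hmap : (p.induce _ hsupp).map (Embedding.induce _).toHom = p := p.map_induce hsupp
  have hcycle : (p.induce _ hsupp).IsCycle :=
    (Walk.isCycle_map_iff_of_injective (f := (Embedding.induce _).toHom)
      Subtype.val_injective).1 (by rw [hmap]; exact hp)
  have hlen : (p.induce _ hsupp).length = p.length :=
    (Walk.length_map ..).symm.trans (congrArg Walk.length hmap)
  exact Nat.not_even_iff_odd.2 (hodd _ hF _ _ hcycle) (hlen ▸ heven)

lemma neighborSet_sup_edge_left (F : SimpleGraph V) {a c : V} (h : a ≠ c) :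
    (F ⊔ edge a c).neighborSet a = insert c (F.neighborSet a) := by
  ext w
  simp only [mem_neighborSet, sup_adj, edge_adj, Set.mem_insert_iff]
  constructor
  · rintro (h | ⟨⟨-, h⟩ | ⟨h, -⟩, -⟩)
    · exact .inr h
    · exact .inl h
    · exact absurd h ‹a ≠ c›
  · rintro (rfl | h)
    · exact .inr ⟨.inl ⟨trivial, rfl⟩, h⟩
    · exact .inl h

lemma IsCubic.ncard_neighborSet_unmatched_sup_edge (hG : IsCubic G) {m : V → V} {a b c : V}
    (hac : a ≠ c) (hnadj : ¬ G.Adj a c) (hab : G.Adj a b) (hadj : G.Adj a (m a)) (hne : m a ≠ b)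
    (hpre : m ⁻¹' {a} = {m a, b}) : ((unmatched G m ⊔ edge a c).neighborSet a).ncard = 2 := by
  have hsub : {m a, b} ⊆ G.neighborSet a := by
    rintro w (rfl | rfl)
    exacts [hadj, hab]
  have hcard : (G.neighborSet a \ {m a, b}).ncard = 1 := by
    rw [hG.ncard_neighborSet_sdiff hsub, Set.ncard_pair hne]
  have hunion : {m a} ∪ m ⁻¹' {a} = {m a, b} := by
    rw [hpre, Set.union_eq_right.2 (by simp)]
  rw [neighborSet_sup_edge_left _ hac, neighborSet_unmatched, hunion,
    Set.ncard_insert_of_notMem (fun h => hnadj h.1)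
      (Set.finite_of_ncard_ne_zero (by rw [hcard]; decide)), hcard]

lemma switchGraph_adj {a b c d v w : V} :
    (switchGraph G a b c d).Adj v w ↔ (G.Adj v w ∧ s(v, w) ≠ s(a, b) ∧ s(v, w) ≠ s(c, d)) ∨
      (s(v, w) ∈ crossEdges a b c d ∧ v ≠ w) := by
  simp [switchGraph, deleteEdges_adj]

lemma unmatched_sup_edge_le_switchGraph {a b c d : V} {m : V → V} (hb : m b = a) (hd : m d = c)
    (hac : a ≠ c) : unmatched G m ⊔ edge a c ≤ switchGraph G a b c d := by
  refine sup_le (fun v w h => switchGraph_adj.2 (.inl ⟨h.1, ?_, ?_⟩)) ?_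
  · intro heq
    rcases Sym2.eq_iff.1 heq with ⟨rfl, rfl⟩ | ⟨rfl, rfl⟩
    exacts [h.2.2 hb, h.2.1 hb]
  · intro heq
    rcases Sym2.eq_iff.1 heq with ⟨rfl, rfl⟩ | ⟨rfl, rfl⟩
    exacts [h.2.2 hd, h.2.1 hd]
  · rw [edge_le_iff]
    exact .inr (switchGraph_adj.2 (.inr ⟨by simp [crossEdges], hac⟩))

lemma IsMatchingOn.ncard_neighborSet_sup_edge (hG : IsCubic G) {a b c d : V} {m : V → V}
    (hm : IsMatchingOn G m {b, d}ᶜ) (hb : m b = a) (hd : m d = c) (hab : G.Adj a b)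
    (hac : a ≠ c) (had : a ≠ d) (hnadj : ¬ G.Adj a c) :
    ((unmatched G m ⊔ edge a c).neighborSet a).ncard = 2 := by
  obtain ⟨hadj, hmem, hinv⟩ := hm a (by simp [hab.ne, had])
  refine hG.ncard_neighborSet_unmatched_sup_edge hac hnadj hab hadj (fun h => hmem (.inl h))
    (subset_antisymm (fun w (hw : m w = a) => ?_) ?_)
  · by_cases hwb : w = b
    · exact .inr hwb
    have hwd : w ≠ d := by
      rintro rfl
      exact hac (hw.symm.trans hd)
    exact .inl (by rw [← hw, (hm w (by simp [hwb, hwd])).2.2])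
  · rintro w (rfl | rfl)
    exacts [hinv, hb]

lemma IsMatchingOn.isTwoFactor_sup_edge (hG : IsCubic G) {a b c d : V} {m : V → V}
    (hm : IsMatchingOn G m {b, d}ᶜ) (hb : m b = a) (hd : m d = c) (hab : G.Adj a b)
    (hcd : G.Adj c d) (hac : a ≠ c) (had : a ≠ d) (hbc : b ≠ c) (hnadj : ¬ G.Adj a c) :
    IsTwoFactor (switchGraph G a b c d) (unmatched G m ⊔ edge a c) := by
  refine ⟨unmatched_sup_edge_le_switchGraph hb hd hac, fun v => ?_⟩
  by_cases hva : v = a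
  · rw [hva]
    exact hm.ncard_neighborSet_sup_edge hG hb hd hab hac had hnadj
  by_cases hvc : v = c
  · rw [hvc, edge_comm]
    rw [Set.pair_comm] at hm
    exact hm.ncard_neighborSet_sup_edge hG hd hb hcd hac.symm hbc.symm fun h => hnadj h.symm
  have hnbr : (unmatched G m ⊔ edge a c).neighborSet v = (unmatched G m).neighborSet v := by
    ext w
    simp [edge_adj, hva, hvc]
  have hadj : G.Adj v (m v) := by
    by_cases hvb : v = b
    · rw [hvb, hb]; exact hab.symm
    by_cases hvd : v = d
    · rw [hvd, hd]; exact hcd.symm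
    exact (hm v (by simp [hvb, hvd])).1
  rw [hnbr]
  refine hG.ncard_neighborSet_unmatched hadj fun w (hw : m w = v) => ?_
  have hwb : w ≠ b := by
    rintro rfl
    exact hva (hw.symm.trans hb)
  have hwd : w ≠ d := by
    rintro rfl
    exact hvc (hw.symm.trans hd)
  simp [← hw, (hm w (by simp [hwb, hwd])).2.2]

lemma IsGadgetPair.not_even_length_of_isMatchingOn_compl (hG : IsCubic G) {a b c d : V}
    {m : V → V} (h : IsGadgetPair G a b c d)
    (hcross : Disjoint G.edgeSet (crossEdges a b c d))
    (hm : IsMatchingOn G m {b, d}ᶜ) (hb : m b = a) (hd : m d = c)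
    {p : (unmatched G m).Walk c a} (hp : p.IsPath) : ¬ Even p.length := by
  intro heven
  obtain ⟨hac, had, hbc, -⟩ := h.independent
  have hnadj : ¬ G.Adj a c := fun h =>
    hcross.notMem_of_mem_left ((G.mem_edgeSet).2 h) (by simp [crossEdges])
  have hF := hm.isTwoFactor_sup_edge hG hb hd h.adj_left h.adj_right hac had hbc hnadj
  have hedge : (unmatched G m ⊔ edge a c).Adj a c := .inr (by simp [edge_adj, hac])
  have hone : (unmatched G m ⊔ edge a c).edgeSet ∩ crossEdges a b c d = {s(a, c)} := by
    have hG' : Disjoint (unmatched G m).edgeSet (crossEdges a b c d) :=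
      hcross.mono_left (edgeSet_mono (unmatched_le m))
    rw [edgeSet_sup, Set.union_inter_distrib_right, hG'.inter_eq, Set.empty_union,
      edgeSet_edge_of_ne hac, Set.inter_eq_left.2 (by simp [crossEdges])]
  have hq : (p.mapLe (le_sup_left : _ ≤ unmatched G m ⊔ edge a c)).IsPath := hp.mapLe _
  have hcycle : (Walk.cons hedge (p.mapLe le_sup_left)).IsCycle := by
    refine (Walk.cons_isCycle_iff _ _).2 ⟨hq, fun hmem => ?_⟩
    rw [Walk.edges_mapLe_eq_edges] at hmem
    exact hnadj (p.adj_of_mem_edges hmem).1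
  have hlen := (h.switch _ hF _ hone a _ hcycle).1 (by simp)
  rw [Walk.length_cons, Walk.length_map] at hlen
  exact Nat.not_even_iff_odd.2 heven.add_one hlen

end TwoFactors

section Swaps

variable {V : Type*} {G : SimpleGraph V}

lemma crossEdges_swap_left (a b c d : V) : crossEdges b a c d = crossEdges a b c d := by
  ext e
  simp only [crossEdges, Set.mem_insert_iff, Set.mem_singleton_iff]
  tauto

lemma crossEdges_swap (a b c d : V) : crossEdges c d a b = crossEdges a b c d := by
  ext e
  simp only [crossEdges, Set.mem_insert_iff, Set.mem_singleton_iff, Sym2.eq_swap (a := c),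
    Sym2.eq_swap (a := d)]
  tauto

lemma IsGadgetPair.swap_left {a b c d : V}
    (h : IsGadgetPair G a b c d) : IsGadgetPair G b a c d := by
  have hs : switchGraph G b a c d = switchGraph G a b c d := by
    rw [switchGraph, switchGraph, crossEdges_swap_left, Sym2.eq_swap (a := b)]
  refine ⟨h.adj_left.symm, h.adj_right, ⟨h.independent.2.2.1, h.independent.2.2.2,
    h.independent.1, h.independent.2.1⟩, fun F hF => ?_, fun F hF => ?_, fun F hF => ?_,
    fun F hF => ?_, ?_⟩
  · rw [F.adj_comm]; exact h.not_avoiding F hF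
  · rw [F.adj_comm b a]; exact h.odd_one F hF
  · rw [F.adj_comm b a]; exact h.odd_both F hF
  · rw [F.adj_comm b a, Sym2.eq_swap]; exact h.different_cycles F hF
  · rw [hs, crossEdges_swap_left]; exact h.switch

lemma IsGadgetPair.swap {a b c d : V}
    (h : IsGadgetPair G a b c d) : IsGadgetPair G c d a b := by
  have hs : switchGraph G c d a b = switchGraph G a b c d := by
    rw [switchGraph, switchGraph, crossEdges_swap, Set.pair_comm]
  obtain ⟨h1, h2, h3, h4⟩ := h.independent
  refine ⟨h.adj_right, h.adj_left, ⟨h1.symm, h3.symm, h2.symm, h4.symm⟩, fun F hF => ?_,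
    fun F hF => ?_, fun F hF h1 h2 => ?_, fun F hF h1 h2 v p hp => ?_, ?_⟩
  · exact (h.not_avoiding F hF).symm
  · rw [xor_comm]; exact h.odd_one F hF
  · exact h.odd_both F hF h2 h1
  · rw [and_comm]; exact h.different_cycles F hF h2 h1 v p hp
  · rw [hs, crossEdges_swap]; exact h.switch

lemma IsGadgetPair.swap_right {a b c d : V}
    (h : IsGadgetPair G a b c d) : IsGadgetPair G a b d c :=
  h.swap.swap_left.swap

end Swaps

section Isomorphisms

variable {V W : Type*} {G : SimpleGraph V} {H : SimpleGraph W}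

lemma IsTwoFactor.comap {F : SimpleGraph W} (hF : IsTwoFactor H F) (φ : G ≃g H) :
    IsTwoFactor G (F.comap φ) := by
  refine ⟨fun v w h => φ.map_adj_iff.1 (hF.1 h), fun v => ?_⟩
  rw [← hF.2 (φ v), ← Nat.card_coe_set_eq, ← Nat.card_coe_set_eq]
  exact Nat.card_congr ((Iso.comap φ.toEquiv F).mapNeighborSet v)

lemma AllCyclesOdd.of_iso {F : SimpleGraph W} {E : SimpleGraph V} (hE : AllCyclesOdd E)
    (ψ : F ≃g E) : AllCyclesOdd F := fun v p hp => by
  simpa using hE _ (p.map ψ.toHom) (hp.map ψ.injective)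

lemma AllCyclesOdd.of_comap {F : SimpleGraph W} (e : V ≃ W) (h : AllCyclesOdd (F.comap e)) :
    AllCyclesOdd F :=
  h.of_iso (Iso.comap e F).symm

lemma IsOddTwoFactored.of_iso (hG : IsOddTwoFactored G) (φ : G ≃g H) : IsOddTwoFactored H :=
  fun _ hF => (hG _ (hF.comap φ)).of_comap φ.toEquiv

/-- The isomorphism of vertex-deleted subgraphs induced by an isomorphism of graphs. -/
def isoInduceCompl (φ : G ≃g H) (x : V) : G.induce {x}ᶜ ≃g H.induce {φ x}ᶜ where
  toEquiv := φ.toEquiv.subtypeEquiv fun v => by simp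
  map_rel_iff' := φ.map_adj_iff

lemma IsBoldEdge.map {x y : V} (h : IsBoldEdge G x y) (φ : G ≃g H) :
    IsBoldEdge H (φ x) (φ y) where
  adj := φ.map_adj_iff.2 h.adj
  odd_delete_left := h.odd_delete_left.of_iso (isoInduceCompl φ x)
  odd_delete_right := h.odd_delete_right.of_iso (isoInduceCompl φ y)
  odd_containing _ hF hxy := (h.odd_containing _ (hF.comap φ) hxy).of_comap φ.toEquiv
  odd_avoiding _ hF hxy := (h.odd_avoiding _ (hF.comap φ) hxy).of_comap φ.toEquiv

lemma image_crossEdges (f : V → W) (a b c d : V) :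
    Sym2.map f '' crossEdges a b c d = crossEdges (f a) (f b) (f c) (f d) := by
  simp [crossEdges, Set.image_insert_eq]

/-- The isomorphism of the graphs in `IsGadgetPair.switch` induced by an isomorphism of graphs. -/
def isoSwitchGraph (φ : G ≃g H) (a b c d : V) :
    switchGraph G a b c d ≃g switchGraph H (φ a) (φ b) (φ c) (φ d) where
  toEquiv := φ.toEquiv
  map_rel_iff' {v w} := by
    have hmem : s(φ v, φ w) ∈ crossEdges (φ a) (φ b) (φ c) (φ d) ↔
        s(v, w) ∈ crossEdges a b c d := by
      rw [← image_crossEdges]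
      exact (Sym2.map.injective φ.injective).mem_set_image (a := s(v, w))
    simp [switchGraph_adj, hmem, φ.map_adj_iff]

lemma mem_edges_map_iso {v w : V} {p : G.Walk v w} (φ : G ≃g H) (e : Sym2 V) :
    Sym2.map φ e ∈ (p.map φ.toHom).edges ↔ e ∈ p.edges := by
  rw [Walk.edges_map]
  exact List.mem_map_of_injective (Sym2.map.injective φ.injective)

lemma IsGadgetPair.map {a b c d : V} (h : IsGadgetPair G a b c d) (φ : G ≃g H) :
    IsGadgetPair H (φ a) (φ b) (φ c) (φ d) where
  adj_left := φ.map_adj_iff.2 h.adj_left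
  adj_right := φ.map_adj_iff.2 h.adj_right
  independent := by simpa using h.independent
  not_avoiding _ hF := h.not_avoiding _ (hF.comap φ)
  odd_one _ hF hab := (h.odd_one _ (hF.comap φ) hab).of_comap φ.toEquiv
  odd_both _ hF hab hcd := (h.odd_both _ (hF.comap φ) hab hcd).of_comap φ.toEquiv
  different_cycles F hF hab hcd v p hp hmem := by
    let ψ : F ≃g F.comap φ := (Iso.comap φ.toEquiv F).symm
    have hψ (v w : V) : s(v, w) = Sym2.map ψ s(φ v, φ w) :=
      (congrArg₂ _ (φ.symm_apply_apply v) (φ.symm_apply_apply w)).symm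
    refine h.different_cycles _ (hF.comap φ) hab hcd _ _ (hp.map (f := ψ.toHom) ψ.injective) ?_
    rw [hψ, hψ, mem_edges_map_iso, mem_edges_map_iso]
    exact hmem
  switch F hF e he v p hp := by
    let ψ : F ≃g F.comap φ := (Iso.comap φ.toEquiv F).symm
    have hinj := Sym2.map.injective φ.injective
    obtain ⟨e, rfl⟩ : ∃ e', Sym2.map φ e' = e :=
      ⟨Sym2.map φ.symm e, by simp [Sym2.map_map]⟩
    have hone : (F.comap φ).edgeSet ∩ crossEdges a b c d = {e} := by
      have hedge : (F.comap φ).edgeSet = Sym2.map φ ⁻¹' F.edgeSet := by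
        ext ⟨v, w⟩
        rfl
      rw [hedge, ← hinj.preimage_image (crossEdges a b c d), image_crossEdges,
        ← Set.preimage_inter, he, ← Set.image_singleton, hinj.preimage_image]
    have hψ : Sym2.map ψ (Sym2.map φ e) = e := by
      induction e with
      | h v w => exact congrArg₂ (s(·, ·)) (φ.symm_apply_apply v) (φ.symm_apply_apply w)
    have hmem : e ∈ (p.map ψ.toHom).edges ↔ Sym2.map φ e ∈ p.edges := by
      rw [← mem_edges_map_iso ψ, hψ]
    have hlen : (p.map ψ.toHom).length = p.length := Walk.length_map ..
    have hswitch := h.switch _ (hF.comap (isoSwitchGraph φ a b c d)) _ hone _ _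
      (hp.map (f := ψ.toHom) ψ.injective)
    exact ⟨fun h => hlen ▸ hswitch.1 (hmem.2 h), fun h => hlen ▸ hswitch.2 (mt hmem.1 h)⟩

end Isomorphisms

section Paths

variable {V : Type*} {F : SimpleGraph V}

lemma exists_isPath_of_isChain {l : List V} {u v : V} (hu : l.head? = some u)
    (hv : l.getLast? = some v) (hchain : l.IsChain F.Adj) (hnodup : l.Nodup) :
    ∃ p : F.Walk u v, p.IsPath ∧ p.support = l := by
  have hne : l ≠ [] := by rintro rfl; simp at hu
  obtain rfl : l.head hne = u := by simpa [List.head?_eq_some_head hne] using hu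
  obtain rfl : l.getLast hne = v := by simpa [List.getLast?_eq_some_getLast hne] using hv
  exact ⟨Walk.ofSupport l hne hchain, by rwa [Walk.isPath_def, Walk.support_ofSupport],
    Walk.support_ofSupport ..⟩

lemma isCycle_cons_of_isPath {u v : V} {p : F.Walk u v} (hp : p.IsPath) (hlen : 2 ≤ p.length)
    (h : F.Adj v u) : (Walk.cons h p).IsCycle := by
  refine (Walk.cons_isCycle_iff _ _).2 ⟨hp, fun hmem => ?_⟩
  rw [Sym2.eq_swap] at hmem
  have := hp.length_eq_one_of_mem_edges hmem
  omega

end Paths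

section Search

variable {n : ℕ} {G : SimpleGraph (Fin n)} [DecidableRel G.Adj]

/-- The number whose binary digits are `1` exactly at the places in `l`. It encodes a finite set in
such a way that the kernel tests membership by arithmetic. -/
def mask (l : List ℕ) : ℕ := l.foldr (fun k s => 2 ^ k ||| s) 0

lemma testBit_mask {l : List ℕ} {k : ℕ} : (mask l).testBit k = true ↔ k ∈ l := by
  induction l with
  | nil => simp [mask]
  | cons j l ih => simp [mask, ← ih, Nat.testBit_two_pow, eq_comm (a := j)]

/-- The neighbours of `v` in increasing order. -/
def neighborList (G : SimpleGraph (Fin n)) [DecidableRel G.Adj] (v : Fin n) : List (Fin n) :=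
  (List.finRange n).filter fun w => G.Adj v w

lemma mem_neighborList {v w : Fin n} : w ∈ neighborList G v ↔ G.Adj v w := by
  simp [neighborList]

/-- All extensions of the partner function `m` that are obtained by going through the list `vs` and
matching each vertex that is not yet in the set encoded by `used` to a neighbour which is not yet
in this set either. -/
def extendMatching (G : SimpleGraph (Fin n)) [DecidableRel G.Adj] :
    List (Fin n) → ℕ → (Fin n → Fin n) → List (Fin n → Fin n)
  | [], _, m => [m]
  | v :: vs, used, m =>
    if used.testBit v then extendMatching G vs used m
    else (neighborList G v).flatMap fun w : Fin n =>
      if used.testBit w = false then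
        extendMatching G vs (used ||| 2 ^ v.val ||| 2 ^ w.val)
          (Function.update (Function.update m v w) w v)
      else []

lemma isMatchingOn_of_mem_extendMatching {vs : List (Fin n)} {used : ℕ} {m m₀ : Fin n → Fin n}
    (hvs : ∀ v : Fin n, v ∈ vs ∨ used.testBit v = true)
    (hm : m ∈ extendMatching G vs used m₀) :
    IsMatchingOn G m {v | ¬ used.testBit v = true} ∧
      ∀ v : Fin n, used.testBit v = true → m v = m₀ v := by
  induction vs generalizing used m₀ with
  | nil =>
    obtain rfl : m = m₀ := by simpa [extendMatching] using hm
    exact ⟨fun v hv => by simp_all, fun _ _ => rfl⟩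
  | cons v vs ih =>
    by_cases hv : used.testBit v = true
    · rw [extendMatching, if_pos hv] at hm
      refine ih (fun w => ?_) hm
      rcases eq_or_ne w v with rfl | hw
      exacts [.inr hv, (hvs w).imp_left fun h => List.mem_of_ne_of_mem hw h]
    rw [extendMatching, if_neg hv] at hm
    obtain ⟨w, hadj, hm⟩ := List.mem_flatMap.1 hm
    obtain ⟨hw, hm⟩ := List.mem_ite_nil_right.1 hm
    rw [mem_neighborList] at hadj
    have hused (z : Fin n) : (used ||| 2 ^ v.val ||| 2 ^ w.val).testBit z = true ↔
        used.testBit z = true ∨ z = v ∨ z = w := by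
      simp [Nat.testBit_two_pow, Fin.val_inj, or_assoc, eq_comm (a := z)]
    obtain ⟨hmatch, hbase⟩ := ih (fun z => by
      rcases eq_or_ne z v with rfl | hz
      · exact .inr ((hused _).2 (.inr (.inl rfl)))
      · exact (hvs z).imp (List.mem_of_ne_of_mem hz) fun h => (hused _).2 (.inl h)) hm
    have hmv : m v = w := by
      rw [hbase v ((hused v).2 (by simp)), Function.update_of_ne hadj.ne, Function.update_self]
    have hmw : m w = v := by rw [hbase w ((hused w).2 (by simp)), Function.update_self]
    have hset : {z : Fin n | ¬ (used ||| 2 ^ v.val ||| 2 ^ w.val).testBit z = true} =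
        {z : Fin n | ¬ used.testBit z = true} \ {v, w} := by
      ext z
      simp only [Set.mem_ofPred_eq, Set.mem_sdiff, hused, not_or, Set.mem_insert_iff,
        Set.mem_singleton_iff]
    rw [hset] at hmatch
    refine ⟨hmatch.of_sdiff_pair hadj hv (by simp [hw]) hmv hmw, fun z hz => ?_⟩
    have hzv : z ≠ v := by rintro rfl; exact hv hz
    have hzw : z ≠ w := by rintro rfl; simp_all
    rw [hbase z ((hused z).2 (.inl hz)), Function.update_of_ne hzw, Function.update_of_ne hzv]

/-- The list of the matchings that cover precisely the vertices outside `l`, as partner functions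
that agree with `m₀` on `l`. -/
def matchingsOff (G : SimpleGraph (Fin n)) [DecidableRel G.Adj] (l : List (Fin n))
    (m₀ : Fin n → Fin n) : List (Fin n → Fin n) :=
  extendMatching G (List.finRange n) (mask (l.map (↑))) m₀

lemma isMatchingOn_of_mem_matchingsOff {l : List (Fin n)} {m m₀ : Fin n → Fin n}
    (hm : m ∈ matchingsOff G l m₀) :
    IsMatchingOn G m {v | v ∉ l} ∧ ∀ v ∈ l, m v = m₀ v := by
  obtain ⟨hmatch, hbase⟩ :=
    isMatchingOn_of_mem_extendMatching (fun v => .inl (List.mem_finRange v)) hm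
  simp only [testBit_mask, List.mem_map_of_injective Fin.val_injective] at hmatch hbase
  exact ⟨hmatch, hbase⟩

/-- The path in `unmatched G m` obtained from the nonempty path `p`, listed from its last vertex to
its first, by prolonging it at most `k` times, each time to some vertex that is not yet on it. -/
def prolongPath (G : SimpleGraph (Fin n)) [DecidableRel G.Adj] (m : Fin n → Fin n) :
    ℕ → List (Fin n) → List (Fin n)
  | k + 1, v :: p =>
    match (neighborList G v).find? fun w => m v ≠ w ∧ m w ≠ v ∧ w ∉ v :: p with
    | some w => prolongPath G m k (w :: v :: p)
    | none => v :: p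
  | _, p => p

lemma prolongPath_spec {m : Fin n → Fin n} (k : ℕ) {p : List (Fin n)}
    (hchain : p.IsChain (unmatched G m).Adj) (hnodup : p.Nodup) :
    (prolongPath G m k p).IsChain (unmatched G m).Adj ∧ (prolongPath G m k p).Nodup ∧
      (prolongPath G m k p).getLast? = p.getLast? := by
  induction k generalizing p with
  | zero => exact ⟨hchain, hnodup, rfl⟩
  | succ k ih =>
    cases p with
    | nil => exact ⟨hchain, hnodup, rfl⟩
    | cons v p =>
      rw [prolongPath]
      split
      · next w hw =>
        obtain ⟨hv, hwv, hmem⟩ : m v ≠ w ∧ m w ≠ v ∧ w ∉ v :: p := by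
          simpa using List.find?_some hw
        have hadj : (unmatched G m).Adj v w :=
          ⟨mem_neighborList.1 (List.mem_of_find?_eq_some hw), hv, hwv⟩
        obtain ⟨h₁, h₂, h₃⟩ := ih (p := w :: v :: p) (hchain.cons_cons hadj.symm)
          (List.nodup_cons.2 ⟨hmem, hnodup⟩)
        exact ⟨h₁, h₂, h₃.trans (List.getLast?_cons_cons ..)⟩
      · exact ⟨hchain, hnodup, rfl⟩

/-- A maximal path in `unmatched G m` with first vertex `v`, listed from its last vertex to its
first. For cubic `G` it runs around the cycle through `v`, or to an end of the component of `v`. -/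
def greedyPath (G : SimpleGraph (Fin n)) [DecidableRel G.Adj] (m : Fin n → Fin n) (v : Fin n) :
    List (Fin n) :=
  prolongPath G m n [v]

lemma exists_isPath_of_head?_greedyPath {m : Fin n → Fin n} {v w : Fin n}
    (h : (greedyPath G m v).head? = some w) :
    ∃ p : (unmatched G m).Walk w v, p.IsPath ∧ p.support = greedyPath G m v := by
  obtain ⟨h₁, h₂, h₃⟩ :=
    prolongPath_spec (G := G) (m := m) n (List.isChain_singleton v) (List.nodup_singleton v)
  exact exists_isPath_of_isChain h h₃ h₁ h₂

end Search

section Criteria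

variable {n : ℕ} {G : SimpleGraph (Fin n)} [DecidableRel G.Adj]

instance (m : Fin n → Fin n) : DecidableRel (unmatched G m).Adj := fun v w =>
  inferInstanceAs (Decidable (G.Adj v w ∧ m v ≠ w ∧ m w ≠ v))

/-- A reason why `ab` and `cd` do not form a gadget-pair: some 2-factor of the graph
`(R - {ab, cd}) ∪ {ac, ad, bc, bd}` contains `ac` and no other edge of `{ac, ad, bc, bd}`, and its
cycle through `ac` is odd. It is given by the matching of the remaining edges at the vertices other
than `b` and `d`. -/
def HasOddSwitch (G : SimpleGraph (Fin n)) [DecidableRel G.Adj] (a b c d : Fin n) : Prop :=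
  (¬ G.Adj a c ∧ ¬ G.Adj a d ∧ ¬ G.Adj b c ∧ ¬ G.Adj b d) ∧
    ∃ m ∈ matchingsOff G [b, d] fun v => if v = b then a else c,
      (greedyPath G m a).head? = some c ∧
        ¬ Even (greedyPath G m a).length

instance (a b c d : Fin n) : Decidable (HasOddSwitch G a b c d) :=
  inferInstanceAs (Decidable (_ ∧ ∃ m ∈ matchingsOff G _ _, _))

lemma IsGadgetPair.not_hasOddSwitch (hG : IsCubic G) {a b c d : Fin n}
    (h : IsGadgetPair G a b c d) : ¬ HasOddSwitch G a b c d := by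
  rintro ⟨hcross, m, hm, hhead, hodd⟩
  obtain ⟨hmatch, hbase⟩ := isMatchingOn_of_mem_matchingsOff hm
  obtain ⟨p, hp, hsupp⟩ := exists_isPath_of_head?_greedyPath hhead
  have hset : {v | v ∉ [b, d]} = ({b, d} : Set (Fin n))ᶜ := by ext; simp
  refine h.not_even_length_of_isMatchingOn_compl hG ?_ (hset ▸ hmatch) (by simp [hbase])
    (by simp [hbase, h.independent.2.2.2.symm]) hp ?_
  · rw [Set.disjoint_right]
    rintro e (rfl | rfl | rfl | rfl)
    exacts [hcross.1, hcross.2.1, hcross.2.2.1, hcross.2.2.2]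
  · rwa [← hsupp, Walk.length_support, Nat.even_add_one, not_not] at hodd

/-- A reason why `ab` and `cd` do not form a gadget-pair: a perfect matching containing both edges,
or an odd switch for some orientation of the two edges. -/
def HasPairObstruction (G : SimpleGraph (Fin n)) [DecidableRel G.Adj] (a b c d : Fin n) : Prop :=
  (∃ m ∈ matchingsOff G [] id, m a = b ∧ m c = d) ∨ HasOddSwitch G a b c d ∨
    HasOddSwitch G b a c d ∨ HasOddSwitch G a b d c ∨ HasOddSwitch G b a d c

instance (a b c d : Fin n) : Decidable (HasPairObstruction G a b c d) :=
  inferInstanceAs (Decidable ((∃ m ∈ matchingsOff G _ _, _) ∨ _))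

lemma not_isGadgetPair_of_forall (hG : IsCubic G)
    (h : ∀ a b, a < b → G.Adj a b → ∀ c d, a < c → c < d → G.Adj c d → b ≠ c → b ≠ d →
      HasPairObstruction G a b c d) (a b c d : Fin n) : ¬ IsGadgetPair G a b c d := by
  intro hp
  wlog hab : a < b generalizing a b
  · exact this b a hp.swap_left (lt_of_le_of_ne (not_lt.1 hab) hp.adj_left.ne')
  wlog hcd : c < d generalizing c d
  · exact this d c hp.swap_right (lt_of_le_of_ne (not_lt.1 hcd) hp.adj_right.ne')
  wlog hac : a < c generalizing a b c d
  · exact this c d hcd a b hp.swap hab (lt_of_le_of_ne (not_lt.1 hac) hp.independent.1.symm)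
  rcases h a b hab hp.adj_left c d hac hcd hp.adj_right hp.independent.2.2.1
    hp.independent.2.2.2 with ⟨m, hm, rfl, rfl⟩ | h | h | h | h
  · have hmatch := (isMatchingOn_of_mem_matchingsOff hm).1
    exact hp.not_isMatchingOn hG (by simpa using hmatch)
  · exact hp.not_hasOddSwitch hG h
  · exact hp.swap_left.not_hasOddSwitch hG h
  · exact hp.swap_right.not_hasOddSwitch hG h
  · exact hp.swap_left.swap_right.not_hasOddSwitch hG h

/-- A reason why no edge at `x` is a bold-edge: some 2-factor of `G - x` has an even cycle. It is
given by the complementary matching. -/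
def HasEvenDeletion (G : SimpleGraph (Fin n)) [DecidableRel G.Adj] (x : Fin n) : Prop :=
  ∃ v, ∃ m ∈ matchingsOff G (x :: neighborList G x) fun _ => x,
    ∃ w ∈ (greedyPath G m v).head?, (unmatched G m).Adj v w ∧
      x ∉ greedyPath G m v ∧ 3 ≤ (greedyPath G m v).length ∧
        Even (greedyPath G m v).length

instance (x : Fin n) : Decidable (HasEvenDeletion G x) :=
  inferInstanceAs (Decidable (∃ _, ∃ m ∈ matchingsOff G _ _, _))

lemma HasEvenDeletion.not_isOddTwoFactored (hG : IsCubic G) {x : Fin n}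
    (h : HasEvenDeletion G x) : ¬ IsOddTwoFactored (G.induce {x}ᶜ) := by
  obtain ⟨v, m, hm, w, hhead, hadj, hx, hlen, heven⟩ := h
  obtain ⟨hmatch, hbase⟩ := isMatchingOn_of_mem_matchingsOff hm
  obtain ⟨p, hp, hsupp⟩ := exists_isPath_of_head?_greedyPath hhead
  rw [← hsupp, Walk.length_support] at hlen heven
  refine hG.not_isOddTwoFactored_induce (by simpa [mem_neighborList] using hmatch) (fun w hw => ?_)
    (isCycle_cons_of_isPath hp (by omega) hadj) heven ?_
  · exact hbase w (by simpa [mem_neighborList] using .inr hw)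
  · rw [Walk.support_cons, List.mem_cons, hsupp, not_or]
    refine ⟨?_, hx⟩
    rintro rfl
    exact hx (hsupp ▸ p.end_mem_support)

lemma isCubic_of_degree (h : ∀ v, G.degree v = 3) : IsCubic G := fun v => by
  rw [Set.ncard_eq_toFinset_card', ← h v]
  rfl

end Criteria

instance (n : ℕ) (l : List (ℕ × ℕ)) : DecidableRel (graphOfEdges n l).Adj := fun i j =>
  let code := mask (l.map fun e => Nat.pair e.1 e.2)
  decidable_of_iff (i ≠ j ∧ (code.testBit (Nat.pair (i + 1) (j + 1)) = true ∨
    code.testBit (Nat.pair (j + 1) (i + 1)) = true)) (by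
      simp [code, testBit_mask, graphOfEdges, Nat.pair_eq_pair])

instance : DecidableRel petersen.Adj := inferInstanceAs (DecidableRel (graphOfEdges _ _).Adj)

instance : DecidableRel P18.Adj := inferInstanceAs (DecidableRel (graphOfEdges _ _).Adj)

instance : DecidableRel P26.Adj := inferInstanceAs (DecidableRel (graphOfEdges _ _).Adj)

instance : DecidableRel P34.Adj := inferInstanceAs (DecidableRel (graphOfEdges _ _).Adj)

lemma isCubic_petersen : IsCubic petersen := isCubic_of_degree (by decide +kernel)

lemma isCubic_P18 : IsCubic P18 := isCubic_of_degree (by decide +kernel)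

lemma isCubic_P26 : IsCubic P26 := isCubic_of_degree (by decide +kernel)

lemma isCubic_P34 : IsCubic P34 := isCubic_of_degree (by decide +kernel)

lemma not_isGadgetPair_P18 : ∀ a b c d, ¬ IsGadgetPair P18 a b c d :=
  not_isGadgetPair_of_forall isCubic_P18 (by decide +kernel)

lemma not_isGadgetPair_P26 : ∀ a b c d, ¬ IsGadgetPair P26 a b c d :=
  not_isGadgetPair_of_forall isCubic_P26 (by decide +kernel)

lemma not_isGadgetPair_P34 : ∀ a b c d, ¬ IsGadgetPair P34 a b c d :=
  not_isGadgetPair_of_forall isCubic_P34 (by decide +kernel)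

lemma hasEvenDeletion_P18 :
    ∀ x, x ∉ ([1, 3, 5, 7, 9, 13, 15, 17] : List (Fin 18)) → HasEvenDeletion P18 x := by
  decide +kernel

lemma hasEvenDeletion_P26 : ∀ x, x ∉ ([1, 4] : List (Fin 26)) → HasEvenDeletion P26 x := by
  decide +kernel

lemma hasEvenDeletion_P34 : ∀ x, HasEvenDeletion P34 x := by
  decide +kernel

lemma IsBoldEdge.mem_of_hasEvenDeletion {n : ℕ} {G : SimpleGraph (Fin n)} [DecidableRel G.Adj]
    {x y : Fin n} (h : IsBoldEdge G x y) (hG : IsCubic G) {l : List (Fin n)}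
    (hl : ∀ v ∉ l, HasEvenDeletion G v) : x ∈ l ∧ y ∈ l := by
  constructor <;> by_contra hmem
  · exact (hl x hmem).not_isOddTwoFactored hG h.odd_delete_left
  · exact (hl y hmem).not_isOddTwoFactored hG h.odd_delete_right

lemma IsBoldEdge.eq_of_P18 {x y : Fin 18} (h : IsBoldEdge P18 x y) :
    (x, y) = (1, 5) ∨ (y, x) = (1, 5) ∨ (x, y) = (3, 7) ∨ (y, x) = (3, 7) := by
  obtain ⟨hx, hy⟩ := h.mem_of_hasEvenDeletion isCubic_P18 hasEvenDeletion_P18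
  have hxy := h.adj
  clear h
  decide +revert +kernel

lemma IsBoldEdge.eq_of_P26 {x y : Fin 26} (h : IsBoldEdge P26 x y) :
    (x, y) = (1, 4) ∨ (y, x) = (1, 4) := by
  obtain ⟨hx, hy⟩ := h.mem_of_hasEvenDeletion isCubic_P26 hasEvenDeletion_P26
  have hne := h.adj.ne
  rcases List.mem_pair.1 hx with rfl | rfl <;> rcases List.mem_pair.1 hy with rfl | rfl <;>
    simp at hne ⊢

lemma not_isBoldEdge_P34 (x y : Fin 34) : ¬ IsBoldEdge P34 x y := fun h =>
  (hasEvenDeletion_P34 x).not_isOddTwoFactored isCubic_P34 h.odd_delete_left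

section DotProducts

variable {V W X : Type u} {L : SimpleGraph V} {R : SimpleGraph W} {H : SimpleGraph X}
  {x y r s t u r' s' t' u' : V} {a b c d : W}

lemma snarkDotProduct_adj (p q : {v : V // v ≠ x ∧ v ≠ y} ⊕ W) :
    (snarkDotProduct L x y r s t u R a b c d).Adj p q ↔
      match p, q with
      | .inl v, .inl v' => L.Adj v v'
      | .inr w, .inr w' => R.Adj w w' ∧ s(w, w') ≠ s(a, b) ∧ s(w, w') ≠ s(c, d)
      | .inl v, .inr w | .inr w, .inl v =>
          (v.1 = r ∧ w = a) ∨ (v.1 = s ∧ w = b) ∨ (v.1 = t ∧ w = c) ∨ (v.1 = u ∧ w = d) := by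
  rw [snarkDotProduct, fromRel_adj]
  rcases p with v | w <;> rcases q with v' | w'
  · simp only [ne_eq, Sum.inl.injEq, L.adj_comm v'.1 v.1, or_self]
    exact ⟨fun h => h.2, fun h => ⟨fun e => h.ne (congrArg _ e), h⟩⟩
  · simp
  · simp
  · simp only [ne_eq, Sum.inr.injEq, R.adj_comm w' w, Sym2.eq_swap (a := w') (b := w), or_self]
    exact ⟨fun h => h.2, fun h => ⟨h.1.ne, h⟩⟩

instance [DecidableEq V] [DecidableEq W] [DecidableRel L.Adj] [DecidableRel R.Adj] :
    DecidableRel (snarkDotProduct L x y r s t u R a b c d).Adj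
  | .inl _, .inl _ | .inl _, .inr _ | .inr _, .inl _ | .inr _, .inr _ =>
    decidable_of_iff' _ (snarkDotProduct_adj _ _)

/-- The isomorphism of dot products induced by isomorphisms of the two factors. -/
def snarkDotProductIso {V' W' : Type v} {L' : SimpleGraph V'} {R' : SimpleGraph W'}
    (φ : L ≃g L') (ψ : R ≃g R') (x y r s t u : V) (a b c d : W) :
    snarkDotProduct L x y r s t u R a b c d ≃g
      snarkDotProduct L' (φ x) (φ y) (φ r) (φ s) (φ t) (φ u) R' (ψ a) (ψ b) (ψ c) (ψ d) where
  toEquiv := Equiv.sumCongr (φ.toEquiv.subtypeEquiv fun v => by simp) ψ.toEquiv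
  map_rel_iff' := by
    have h : ∀ a b c d : W, s(ψ a, ψ b) = s(ψ c, ψ d) ↔ s(a, b) = s(c, d) := by simp
    rintro (v | w) (v' | w') <;> rw [snarkDotProduct_adj, snarkDotProduct_adj] <;>
      simp [h, φ.map_adj_iff, ψ.map_adj_iff]

/-- Every dot product of `L` at `xy` and `R` at a gadget-pair, with the neighbours `r`, `s`, `t`,
`u` of `x` and `y` taken in this order, is isomorphic to `H`. -/
def GadgetDotsIso (L : SimpleGraph V) (x y r s t u : V) (R : SimpleGraph W)
    (H : SimpleGraph X) : Prop :=
  ∀ a b c d, IsGadgetPair R a b c d →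
    Nonempty (snarkDotProduct L x y r s t u R a b c d ≃g H)

namespace GadgetDotsIso

lemma swap_left (h : GadgetDotsIso L x y r s t u R H) : GadgetDotsIso L x y s r t u R H := by
  intro a b c d hg
  obtain ⟨e⟩ := h b a c d hg.swap_left
  refine ⟨RelIso.trans ⟨Equiv.refl _, ?_⟩ e⟩
  rintro (v | w) (v' | w') <;> rw [snarkDotProduct_adj, snarkDotProduct_adj] <;>
    simp only [Equiv.refl_apply, Sym2.eq_swap (a := a) (b := b)] <;> tauto

lemma swap (h : GadgetDotsIso L x y r s t u R H) : GadgetDotsIso L y x t u r s R H := by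
  intro a b c d hg
  obtain ⟨e⟩ := h c d a b hg.swap
  refine ⟨RelIso.trans ⟨Equiv.sumCongr (Equiv.subtypeEquivRight fun v => and_comm)
    (Equiv.refl W), ?_⟩ e⟩
  rintro (v | w) (v' | w') <;> rw [snarkDotProduct_adj, snarkDotProduct_adj] <;> simp <;> tauto

lemma swap_right (h : GadgetDotsIso L x y r s t u R H) : GadgetDotsIso L x y r s u t R H :=
  h.swap.swap_left.swap

lemma of_pair_eq (h : GadgetDotsIso L x y r s t u R H) (hr : ({r', s'} : Set V) = {r, s})
    (ht : ({t', u'} : Set V) = {t, u}) : GadgetDotsIso L x y r' s' t' u' R H := by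
  rw [Set.pair_eq_pair_iff] at hr ht
  rcases hr with ⟨rfl, rfl⟩ | ⟨rfl, rfl⟩ <;> rcases ht with ⟨rfl, rfl⟩ | ⟨rfl, rfl⟩
  exacts [h, h.swap_right, h.swap_left, h.swap_left.swap_right]

lemma map {V' : Type u} {L' : SimpleGraph V'} (h : GadgetDotsIso L x y r s t u R H)
    (φ : L ≃g L') : GadgetDotsIso L' (φ x) (φ y) (φ r) (φ s) (φ t) (φ u) R H := by
  intro a b c d hg
  obtain ⟨e⟩ := h a b c d hg
  exact ⟨(snarkDotProductIso φ Iso.refl x y r s t u a b c d).symm.trans e⟩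

end GadgetDotsIso

end DotProducts

section PetersenSymmetry

/-- The vertices `p`, `q`, `r`, `s` of the Petersen graph form a walk without backtracking. -/
def IsThreeArc (p q r s : Fin 10) : Prop :=
  petersen.Adj p q ∧ petersen.Adj q r ∧ petersen.Adj r s ∧ p ≠ r ∧ q ≠ s

instance (p q r s : Fin 10) : Decidable (IsThreeArc p q r s) :=
  inferInstanceAs (Decidable (_ ∧ _))

/-- The common neighbour of two vertices of the Petersen graph at distance two. -/
def petersenMid (v w : Fin 10) : Fin 10 :=
  ((neighborList petersen v).filter (· ∈ neighborList petersen w)).headD 0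

/-- The automorphism of the Petersen graph that takes the path with labels `5 1 2 3` to
`p q r s`. -/
def petersenFrame (p q r s : Fin 10) : Fin 10 → Fin 10 :=
  let third v a b := ((neighborList petersen v).filter (· ∉ [a, b])).headD 0
  let m := petersenMid p s
  ![q, r, s, m, p, third q p r, third r q s, third s r m, third m s p, third p m q]

lemma bijective_petersenFrame :
    ∀ p q r s, IsThreeArc p q r s → Function.Bijective (petersenFrame p q r s) := by
  decide +kernel

lemma adj_petersenFrame : ∀ p q r s, IsThreeArc p q r s → ∀ v w,
    petersen.Adj (petersenFrame p q r s v) (petersenFrame p q r s w) ↔ petersen.Adj v w := by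
  decide +kernel

lemma IsThreeArc.exists_iso {p q r s : Fin 10} (h : IsThreeArc p q r s) :
    ∃ φ : petersen ≃g petersen, ⇑φ = petersenFrame p q r s :=
  ⟨⟨Equiv.ofBijective _ (bijective_petersenFrame p q r s h),
    fun {v w} => adj_petersenFrame p q r s h v w⟩, rfl⟩

lemma exists_matching_or_isThreeArc : ∀ a b, petersen.Adj a b → ∀ c d, petersen.Adj c d →
    a ≠ c ∧ a ≠ d ∧ b ≠ c ∧ b ≠ d →
    (∃ m ∈ matchingsOff petersen [] id, m a = b ∧ m c = d) ∨
      IsThreeArc b a (petersenMid a c) c ∧ petersenFrame b a (petersenMid a c) c 7 = d := by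
  decide +kernel

lemma IsGadgetPair.exists_petersen_iso {a b c d : Fin 10} (h : IsGadgetPair petersen a b c d) :
    ∃ φ : petersen ≃g petersen, φ 0 = a ∧ φ 4 = b ∧ φ 2 = c ∧ φ 7 = d := by
  rcases exists_matching_or_isThreeArc a b h.adj_left c d h.adj_right h.independent with
    ⟨m, hm, rfl, rfl⟩ | ⟨harc, hd⟩
  · refine (h.not_isMatchingOn isCubic_petersen ?_).elim
    simpa using (isMatchingOn_of_mem_matchingsOff hm).1
  obtain ⟨φ, hφ⟩ := harc.exists_iso
  exact ⟨φ, by rw [hφ]; rfl, by rw [hφ]; rfl, by rw [hφ]; rfl, by rw [hφ, hd]⟩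

lemma GadgetDotsIso.of_petersen {V X : Type} {L : SimpleGraph V} {H : SimpleGraph X}
    {x y r s t u : V}
    (h : Nonempty (snarkDotProduct L x y r s t u petersen 0 4 2 7 ≃g H)) :
    GadgetDotsIso L x y r s t u petersen H := by
  intro a b c d hg
  obtain ⟨φ, rfl, rfl, rfl, rfl⟩ := hg.exists_petersen_iso
  exact h.map (snarkDotProductIso Iso.refl φ x y r s t u 0 4 2 7).symm.trans

end PetersenSymmetry

section Certificates

lemma nonempty_dotIso_P18 :
    Nonempty (snarkDotProduct petersen 0 1 4 5 2 6 petersen 0 4 2 7 ≃g P18) :=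
  ⟨Equiv.ofBijective (Sum.elim (fun v => ![0, 0, 0, 1, 2, 4, 6, 3, 5, 7] v.1)
    ![10, 9, 8, 13, 14, 17, 11, 16, 12, 15]) (by decide +kernel),
    fun {p q} => by revert p q; decide +kernel⟩

lemma nonempty_dotIso_P26 :
    Nonempty (snarkDotProduct P18 1 5 0 2 4 6 petersen 0 4 2 7 ≃g P26) :=
  ⟨Equiv.ofBijective (Sum.elim
    (fun v => ![0, 0, 3, 1, 2, 0, 5, 4, 6, 7, 8, 9, 10, 11, 12, 13, 14, 15] v.1)
    ![18, 17, 16, 21, 22, 25, 19, 24, 20, 23]) (by decide +kernel),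
    fun {p q} => by revert p q; decide +kernel⟩

lemma nonempty_dotIso_P26' :
    Nonempty (snarkDotProduct P18 3 7 0 4 2 6 petersen 0 4 2 7 ≃g P26) :=
  ⟨Equiv.ofBijective (Sum.elim
    (fun v => ![0, 1, 2, 0, 3, 4, 5, 0, 6, 11, 12, 10, 9, 7, 8, 15, 14, 13] v.1)
    ![18, 17, 16, 21, 22, 25, 19, 24, 20, 23]) (by decide +kernel),
    fun {p q} => by revert p q; decide +kernel⟩

lemma nonempty_dotIso_P34 :
    Nonempty (snarkDotProduct P26 1 4 0 2 3 5 petersen 0 4 2 7 ≃g P34) :=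
  ⟨Equiv.ofBijective (Sum.elim
    (fun v => ![0, 0, 3, 1, 0, 2, 4, 5, 6, 7, 8, 9, 10, 11, 12, 13, 14, 15, 16, 17, 18, 19, 20, 21,
      22, 23] v.1) ![24, 33, 32, 31, 30, 25, 28, 26, 27, 29]) (by decide +kernel),
    fun {p q} => by revert p q; decide +kernel⟩

lemma image_neighborSet_sdiff {V W : Type*} {G : SimpleGraph V} {H : SimpleGraph W} (φ : G ≃g H)
    {x y r s : V} (h : G.neighborSet x \ {y} = {r, s}) :
    H.neighborSet (φ x) \ {φ y} = {φ r, φ s} := by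
  ext w
  obtain ⟨v, rfl⟩ := φ.surjective w
  have := Set.ext_iff.1 h v
  simpa [φ.injective.eq_iff, φ.map_adj_iff] using this

lemma gadgetDotsIso_petersen {x y r s t u : Fin 10} (hxy : petersen.Adj x y)
    (hx : petersen.neighborSet x \ {y} = {r, s}) (hy : petersen.neighborSet y \ {x} = {t, u}) :
    GadgetDotsIso petersen x y r s t u petersen P18 := by
  obtain ⟨hxr, hry⟩ : r ∈ petersen.neighborSet x \ {y} := hx ▸ Set.mem_insert r {s}
  obtain ⟨hyt, htx⟩ : t ∈ petersen.neighborSet y \ {x} := hy ▸ Set.mem_insert t {u}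
  obtain ⟨φ, hφ⟩ := IsThreeArc.exists_iso ⟨hxr.symm, hxy, hyt, hry, Ne.symm htx⟩
  obtain rfl : φ 0 = x := by rw [hφ]; rfl
  obtain rfl : φ 1 = y := by rw [hφ]; rfl
  have h0 : petersen.neighborSet 0 \ {1} = {4, 5} := Set.ext (by decide +kernel)
  have h1 : petersen.neighborSet 1 \ {0} = {2, 6} := Set.ext (by decide +kernel)
  exact ((GadgetDotsIso.of_petersen nonempty_dotIso_P18).map φ).of_pair_eq
    (hx ▸ image_neighborSet_sdiff φ h0) (hy ▸ image_neighborSet_sdiff φ h1)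

lemma IsBoldEdge.gadgetDotsIso_P18 {x y r s t u : Fin 18} (h : IsBoldEdge P18 x y)
    (hx : P18.neighborSet x \ {y} = {r, s}) (hy : P18.neighborSet y \ {x} = {t, u}) :
    GadgetDotsIso P18 x y r s t u petersen P26 := by
  have h1 : P18.neighborSet 1 \ {5} = {0, 2} := Set.ext (by decide +kernel)
  have h5 : P18.neighborSet 5 \ {1} = {4, 6} := Set.ext (by decide +kernel)
  have h3 : P18.neighborSet 3 \ {7} = {0, 4} := Set.ext (by decide +kernel)
  have h7 : P18.neighborSet 7 \ {3} = {2, 6} := Set.ext (by decide +kernel)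
  have h15 := GadgetDotsIso.of_petersen nonempty_dotIso_P26
  have h37 := GadgetDotsIso.of_petersen nonempty_dotIso_P26'
  rcases h.eq_of_P18 with e | e | e | e <;> obtain ⟨rfl, rfl⟩ := Prod.mk.inj e
  · exact h15.of_pair_eq (hx ▸ h1) (hy ▸ h5)
  · exact h15.swap.of_pair_eq (hx ▸ h5) (hy ▸ h1)
  · exact h37.of_pair_eq (hx ▸ h3) (hy ▸ h7)
  · exact h37.swap.of_pair_eq (hx ▸ h7) (hy ▸ h3)

lemma IsBoldEdge.gadgetDotsIso_P26 {x y r s t u : Fin 26} (h : IsBoldEdge P26 x y)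
    (hx : P26.neighborSet x \ {y} = {r, s}) (hy : P26.neighborSet y \ {x} = {t, u}) :
    GadgetDotsIso P26 x y r s t u petersen P34 := by
  have h1 : P26.neighborSet 1 \ {4} = {0, 2} := Set.ext (by decide +kernel)
  have h4 : P26.neighborSet 4 \ {1} = {3, 5} := Set.ext (by decide +kernel)
  have h14 := GadgetDotsIso.of_petersen nonempty_dotIso_P34
  rcases h.eq_of_P26 with e | e <;> obtain ⟨rfl, rfl⟩ := Prod.mk.inj e
  · exact h14.of_pair_eq (hx ▸ h1) (hy ▸ h4)
  · exact h14.swap.of_pair_eq (hx ▸ h4) (hy ▸ h1)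

end Certificates

section RingMatchings

variable {t : ℕ}

/-- The flower snark in coordinates in which all claws look alike: the hub of the claw `i` is
`(i, none)`, its leaves are `(i, some x)`, and every link between consecutive claws changes the
sign of the row `x`. For odd `t` the sign changes amount to the twist in `J(t)`. -/
def flowerRing (t : ℕ) : SimpleGraph (ZMod t × Option (ZMod 3)) :=
  SimpleGraph.fromRel fun v w =>
    match v, w with
    | (i, none), (j, some _) => i = j
    | (i, some x), (j, some y) => j = i + 1 ∧ y = -x
    | _, _ => False

lemma flowerRing_adj_spoke (i : ZMod t) (x : ZMod 3) :
    (flowerRing t).Adj (i, none) (i, some x) := by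
  simp [flowerRing]

lemma flowerRing_adj_link [Fact (1 < t)] (i : ZMod t) (x : ZMod 3) :
    (flowerRing t).Adj (i, some x) (i + 1, some (-x)) := by
  simp [flowerRing]

lemma flowerRing_adj_leaf_iff [Fact (1 < t)] (i : ZMod t) (x : ZMod 3)
    (v : ZMod t × Option (ZMod 3)) : (flowerRing t).Adj (i, some x) v ↔
      v = (i, none) ∨ v = (i + 1, some (-x)) ∨ v = (i - 1, some (-x)) := by
  obtain ⟨j, _ | y⟩ := v
  · simp [flowerRing]
  · have h : i = j + 1 ↔ j = i - 1 := by rw [eq_sub_iff_add_eq, eq_comm]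
    have h1 : (1 : ZMod t) ≠ 0 := one_ne_zero
    simp [flowerRing, h, @eq_comm _ x, neg_eq_iff_eq_neg]
    grind

lemma isCubic_flowerRing (ht : 3 ≤ t) : IsCubic (flowerRing t) := by
  have : Fact (1 < t) := ⟨by omega⟩
  have : Fact (2 < t) := ⟨ht⟩
  rintro ⟨i, _ | x⟩ <;> rw [Set.ncard_eq_three]
  · have h : (0 : ZMod 3) ≠ 2 ∧ (1 : ZMod 3) ≠ 2 ∧ ∀ y : ZMod 3, y = 0 ∨ y = 1 ∨ y = 2 := by decide
    refine ⟨(i, some 0), (i, some 1), (i, some 2), by simp, by simp [h], by simp [h], ?_⟩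
    ext ⟨j, _ | y⟩
    · simp [flowerRing]
    · simp [flowerRing, ← and_or_left, h, eq_comm]
  · have h : (1 : ZMod t) ≠ -1 := ZMod.neg_one_ne_one.symm
    refine ⟨(i, none), (i + 1, some (-x)), (i - 1, some (-x)), by simp, by simp,
      by simp [sub_eq_add_neg, h], ?_⟩
    ext v
    simp [flowerRing_adj_leaf_iff]

/-- The automorphism that shifts the claws by `k`. -/
def flowerRingRotation (k : ZMod t) : flowerRing t ≃g flowerRing t where
  toEquiv := (Equiv.addRight k).prodCongr (Equiv.refl _)
  map_rel_iff' {v w} := by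
    obtain ⟨i, _ | x⟩ := v <;> obtain ⟨j, _ | y⟩ := w <;>
      simp [flowerRing, add_right_comm _ k 1]

lemma flowerRingRotation_apply (k i : ZMod t) (x : Option (ZMod 3)) :
    flowerRingRotation k (i, x) = (i + k, x) := rfl

/-- The source and the target of an edge whose source lies in the claw `i`: for `(false, x)` the
spoke to the leaf in row `x`, for `(true, x)` the link from this leaf to the next claw. -/
def ringEdge (i : ZMod t) : Bool × ZMod 3 →
    (ZMod t × Option (ZMod 3)) × (ZMod t × Option (ZMod 3))
  | (false, x) => ((i, none), (i, some x))
  | (true, x) => ((i, some x), (i + 1, some (-x)))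

lemma exists_ringEdge {v w : ZMod t × Option (ZMod 3)} (h : (flowerRing t).Adj v w) :
    ∃ i e, ringEdge i e = (v, w) ∨ ringEdge i e = (w, v) := by
  obtain ⟨-, h⟩ := h
  match v, w, h with
  | (i, none), (_, some x), .inl rfl => exact ⟨i, (false, x), .inl rfl⟩
  | (_, some x), (i, none), .inr rfl => exact ⟨i, (false, x), .inr rfl⟩
  | (i, some x), (_, some _), .inl ⟨rfl, rfl⟩ => exact ⟨i, (true, x), .inl rfl⟩
  | (_, some _), (i, some x), .inr ⟨rfl, rfl⟩ => exact ⟨i, (true, x), .inr rfl⟩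

open Classical in
/-- The partner function that matches the hub of the claw `i` to the leaf in row `r i`, the leaf in
row `x` of this claw along its forward link if `f i x`, and the other leaves along their backward
links. -/
noncomputable def ringPartner (r : ZMod t → ZMod 3) (f : ZMod t → ZMod 3 → Prop) :
    ZMod t × Option (ZMod 3) → ZMod t × Option (ZMod 3)
  | (i, none) => (i, some (r i))
  | (i, some x) => if f i x then (i + 1, some (-x)) else if x = r i then (i, none)
      else (i - 1, some (-x))

variable {r : ZMod t → ZMod 3} {f : ZMod t → ZMod 3 → Prop} {i : ZMod t} {x : ZMod 3}

lemma ringPartner_hub : ringPartner r f (i, none) = (i, some (r i)) := rfl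

lemma ringPartner_forward (h : f i x) : ringPartner r f (i, some x) = (i + 1, some (-x)) :=
  if_pos h

lemma ringPartner_spoke (h : ¬ f i (r i)) : ringPartner r f (i, some (r i)) = (i, none) := by
  rw [ringPartner, if_neg h, if_pos rfl]

lemma ringPartner_backward (h : ¬ f i x) (hx : x ≠ r i) :
    ringPartner r f (i, some x) = (i - 1, some (-x)) := by
  rw [ringPartner, if_neg h, if_neg hx]

lemma adj_ringPartner [Fact (1 < t)] (v : ZMod t × Option (ZMod 3)) :
    (flowerRing t).Adj v (ringPartner r f v) := by
  obtain ⟨i, _ | x⟩ := v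
  · exact flowerRing_adj_spoke i _
  by_cases h : f i x
  · rw [ringPartner_forward h]
    exact flowerRing_adj_link i x
  by_cases hx : x = r i
  · subst hx
    rw [ringPartner_spoke h]
    exact (flowerRing_adj_spoke i _).symm
  · rw [ringPartner_backward h hx, flowerRing_adj_leaf_iff]
    exact .inr (.inr rfl)

lemma ringPartner_ringPartner_hub (h : ¬ f i (r i)) :
    ringPartner r f (ringPartner r f (i, none)) = (i, none) := by
  rw [ringPartner_hub, ringPartner_spoke h]

lemma ringPartner_ringPartner_leaf (hfwd : f i x → ¬ f (i + 1) (-x) ∧ -x ≠ r (i + 1))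
    (hbwd : ¬ f i x → x ≠ r i → f (i - 1) (-x)) :
    ringPartner r f (ringPartner r f (i, some x)) = (i, some x) := by
  by_cases h : f i x
  · rw [ringPartner_forward h, ringPartner_backward (hfwd h).1 (hfwd h).2]
    simp
  by_cases hx : x = r i
  · subst hx
    rw [ringPartner_spoke h, ringPartner_hub]
  · rw [ringPartner_backward h hx, ringPartner_forward (hbwd h hx)]
    simp

lemma isMatchingOn_univ_ringPartner [Fact (1 < t)] {b : ZMod t → ZMod 3}
    (hb : ∀ i, b i + b (i + 1) ≠ 0) :
    IsMatchingOn (flowerRing t)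
      (ringPartner (fun i => b (i + 1) - b i) fun i x => x = -b (i + 1)) Set.univ := by
  refine fun v _ => ⟨adj_ringPartner v, Set.mem_univ _, ?_⟩
  obtain ⟨i, _ | x⟩ := v
  · have h : ∀ y z : ZMod 3, y + z ≠ 0 → z - y ≠ -z := by decide
    exact ringPartner_ringPartner_hub (h _ _ (hb i))
  refine ringPartner_ringPartner_leaf ?_ ?_
  · have h : ∀ y z : ZMod 3, y + z ≠ 0 → - -y ≠ -z ∧ - -y ≠ z - y := by decide
    rintro rfl
    exact h _ _ (hb (i + 1))
  · have h : ∀ x y z : ZMod 3, y + z ≠ 0 → x ≠ -z → x ≠ z - y → -x = -y := by decide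
    rw [sub_add_cancel]
    exact h _ _ _ (hb i)

/-- In a matching that uses one link between any two consecutive claws, the edge `e` of a claw is
matched if and only if the leaves at which the matched links from the previous claw and to the next
claw end lie in rows `y` and `z` with `RingStep e y z`. -/
def RingStep : Bool × ZMod 3 → ZMod 3 → ZMod 3 → Prop
  | (false, x), y, z => y + z ≠ 0 ∧ z - y = x
  | (true, x), y, z => y + z ≠ 0 ∧ z = -x

instance (e : Bool × ZMod 3) (y z : ZMod 3) : Decidable (RingStep e y z) :=
  match e with
  | (false, _) | (true, _) => inferInstanceAs (Decidable (_ ∧ _))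

lemma ringPartner_ringEdge {b : ZMod t → ZMod 3} {e : Bool × ZMod 3}
    (h : RingStep e (b i) (b (i + 1))) :
    ringPartner (fun i => b (i + 1) - b i) (fun i x => x = -b (i + 1)) (ringEdge i e).1 =
      (ringEdge i e).2 := by
  obtain ⟨_ | _, x⟩ := e
  · rw [ringEdge, ringPartner_hub, h.2]
  · exact ringPartner_forward (by rw [h.2, neg_neg])

/-- The first `n` steps of the sequence `f` are steps of a matching with one link between any two
consecutive claws. -/
def IsRowWalk (f : ℕ → ZMod 3) (n : ℕ) : Prop := ∀ i < n, f i + f (i + 1) ≠ 0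

lemma IsRowWalk.exists_extension {f : ℕ → ZMod 3} {n : ℕ} (hf : IsRowWalk f n) (m : ℕ)
    {z : ZMod 3} (hz : m = 0 → f n + z ≠ 0) :
    ∃ g, IsRowWalk g (n + m + 1) ∧ g (n + m + 1) = z ∧ ∀ i ≤ n, g i = f i := by
  have step (f : ℕ → ZMod 3) (n : ℕ) (y : ZMod 3) (hf : IsRowWalk f n) (hy : f n + y ≠ 0) :
      IsRowWalk (Function.update f (n + 1) y) (n + 1) := by
    intro i hi
    rw [Function.update_of_ne (by omega)]
    rcases Nat.lt_succ_iff_lt_or_eq.1 hi with hi | rfl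
    · rw [Function.update_of_ne (by omega)]
      exact hf i hi
    · rwa [Function.update_self]
  induction m generalizing f n with
  | zero =>
    exact ⟨_, step f n z hf (hz rfl), Function.update_self ..,
      fun i hi => Function.update_of_ne (by omega) ..⟩
  | succ m ih =>
    have h : ∀ x z : ZMod 3, ∃ y, x + y ≠ 0 ∧ y + z ≠ 0 := by decide
    obtain ⟨y, hxy, hyz⟩ := h (f n) z
    obtain ⟨g, hg, hgz, hgf⟩ := ih (step f n y hf hxy) fun _ => by rwa [Function.update_self]
    rw [add_assoc n 1, add_comm 1] at hg hgz
    exact ⟨g, hg, hgz, fun i hi => by rw [hgf i (by omega), Function.update_of_ne (by omega)]⟩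

lemma RingStep.add_ne_zero {e : Bool × ZMod 3} {y z : ZMod 3} (h : RingStep e y z) :
    y + z ≠ 0 := by
  obtain ⟨_ | _, x⟩ := e <;> exact h.1

lemma RingStep.exists_isRowWalk {e : Bool × ZMod 3} {y z : ZMod 3} (h : RingStep e y z) :
    ∃ f, IsRowWalk f 1 ∧ f 0 = y ∧ f 1 = z := by
  obtain ⟨f, hf, hz, hy⟩ := IsRowWalk.exists_extension (f := fun _ => y) (n := 0)
    (fun i hi => absurd hi i.not_lt_zero) 0 fun _ => h.add_ne_zero
  exact ⟨f, hf, hy 0 le_rfl, hz⟩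

lemma exists_isRowWalk_ringStep {e e' : Bool × ZMod 3} {j : ℕ}
    (h₀ : j = 0 → e.1 ≠ e'.1 ∧ e.2 ≠ e'.2) (h₁ : j = 1 → ¬ (e.1 = true ∧ e'.2 = -e.2)) :
    ∃ f, IsRowWalk f (j + 1) ∧ RingStep e (f 0) (f 1) ∧ RingStep e' (f j) (f (j + 1)) := by
  obtain rfl | rfl | hj : j = 0 ∨ j = 1 ∨ 2 ≤ j := by omega
  · have key : ∀ e e' : Bool × ZMod 3, e.1 ≠ e'.1 ∧ e.2 ≠ e'.2 →
        ∃ y z, RingStep e y z ∧ RingStep e' y z := by decide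
    obtain ⟨y, z, h, h'⟩ := key e e' (h₀ rfl)
    obtain ⟨f, hf, rfl, rfl⟩ := h.exists_isRowWalk
    exact ⟨f, hf, h, h'⟩
  · have key : ∀ e e' : Bool × ZMod 3, ¬ (e.1 = true ∧ e'.2 = -e.2) →
        ∃ x y z, RingStep e x y ∧ RingStep e' y z := by decide
    obtain ⟨x, y, z, h, h'⟩ := key e e' (h₁ rfl)
    obtain ⟨f, hf, rfl, rfl⟩ := h.exists_isRowWalk
    obtain ⟨g, hg, rfl, hgf⟩ := hf.exists_extension 0 fun _ => h'.add_ne_zero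
    rw [← hgf 0 zero_le_one, ← hgf 1 le_rfl] at h
    rw [← hgf 1 le_rfl] at h'
    exact ⟨g, hg, h, h'⟩
  · have key : ∀ e e' : Bool × ZMod 3,
        ∃ y z y' z', RingStep e y z ∧ z + y' ≠ 0 ∧ RingStep e' y' z' := by decide
    obtain ⟨j, rfl⟩ := Nat.exists_eq_add_of_le hj
    obtain ⟨y, z, y', z', h, hzy, h'⟩ := key e e'
    obtain ⟨f, hf, rfl, rfl⟩ := h.exists_isRowWalk
    obtain ⟨g, hg, rfl, hgf⟩ := hf.exists_extension j fun _ => hzy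
    rw [add_right_comm] at hg h'
    obtain ⟨k, hk, rfl, hkg⟩ := hg.exists_extension 0 fun _ => h'.add_ne_zero
    rw [← hgf 0 zero_le_one, ← hgf 1 le_rfl, ← hkg 0 (by omega), ← hkg 1 (by omega)] at h
    rw [← hkg _ le_rfl] at h'
    exact ⟨k, hk, h, h'⟩

lemma val_add_one_of_lt {i : ZMod t} (h : i.val + 1 < t) : (i + 1).val = i.val + 1 := by
  have : (1 : ZMod t).val = 1 := ZMod.val_one'' (by omega)
  rw [ZMod.val_add_of_lt (by rwa [this]), this]

lemma add_one_eq_zero_of_val [NeZero t] {i : ZMod t} (h : i.val + 1 = t) : i + 1 = 0 := by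
  rw [← ZMod.natCast_zmod_val i, ← Nat.cast_succ, Nat.succ_eq_add_one, h, ZMod.natCast_self]

/-- A sequence of `t` steps that returns to its start winds once around the ring. -/
lemma IsRowWalk.exists_ring [NeZero t] {f : ℕ → ZMod 3} (hf : IsRowWalk f t) (h : f t = f 0)
    (i : ZMod t) :
    ∃ b : ZMod t → ZMod 3, (∀ k, b k + b (k + 1) ≠ 0) ∧ ∀ j ≤ t, b (i + j) = f j := by
  refine ⟨fun k => f (k - i).val, fun k => ?_, fun j hj => ?_⟩
  · have hlt := (k - i).val_lt
    beta_reduce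
    rw [add_sub_right_comm]
    obtain h1 | h1 : (k - i).val + 1 < t ∨ (k - i).val + 1 = t := by omega
    · rw [val_add_one_of_lt h1]
      exact hf _ hlt
    · rw [add_one_eq_zero_of_val h1, ZMod.val_zero, ← h, ← congrArg f h1]
      exact hf _ hlt
  · beta_reduce
    rw [add_sub_cancel_left]
    obtain hj | rfl := hj.lt_or_eq
    · rw [ZMod.val_natCast_of_lt hj]
    · rw [ZMod.natCast_self, ZMod.val_zero, h]

lemma not_isGadgetPair_ringEdge [Fact (1 < t)] (hcubic : IsCubic (flowerRing t))
    {e e' : Bool × ZMod 3} {j : ℕ} (hj : j + 3 ≤ t) (h₀ : j = 0 → e.1 ≠ e'.1 ∧ e.2 ≠ e'.2)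
    (h₁ : j = 1 → ¬ (e.1 = true ∧ e'.2 = -e.2)) (i : ZMod t) :
    ¬ IsGadgetPair (flowerRing t) (ringEdge i e).1 (ringEdge i e).2
      (ringEdge (i + (j : ZMod t)) e').1 (ringEdge (i + (j : ZMod t)) e').2 := by
  have : NeZero t := ⟨by omega⟩
  obtain ⟨f, hf, he, he'⟩ := exists_isRowWalk_ringStep h₀ h₁
  obtain ⟨m, rfl⟩ := Nat.exists_eq_add_of_le hj
  obtain ⟨g, hg, hgz, hgf⟩ := hf.exists_extension (m + 1) (z := f 0) (by omega)
  rw [show j + 1 + (m + 1) + 1 = j + 3 + m by omega, ← hgf 0 (by omega)] at *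
  obtain ⟨b, hb, hbg⟩ := hg.exists_ring hgz i
  have hstep : RingStep e (b i) (b (i + 1)) := by
    have h0 := hbg 0 (by omega)
    have h1 := hbg 1 (by omega)
    rw [Nat.cast_zero, add_zero] at h0
    rw [Nat.cast_one] at h1
    rwa [h0, h1, hgf 1 (by omega)]
  have hstep' : RingStep e' (b (i + j)) (b (i + j + 1)) := by
    rwa [add_assoc i, ← Nat.cast_succ, hbg j (by omega), hbg (j + 1) (by omega),
      hgf j (by omega), hgf (j + 1) le_rfl]
  intro h
  rw [← ringPartner_ringEdge hstep, ← ringPartner_ringEdge hstep'] at h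
  exact h.not_isMatchingOn hcubic (isMatchingOn_univ_ringPartner hb)

end RingMatchings

section RingGadgetPairs

variable {t : ℕ}

lemma val_sub_one_of_ne [NeZero t] {i : ZMod t} (h : i.val ≠ 0) : (i - 1).val = i.val - 1 := by
  have hlt := i.val_lt
  have h1 : (1 : ZMod t).val = 1 := ZMod.val_one'' (by omega)
  rw [ZMod.val_sub (by omega), h1]

lemma ringPartner_ringPartner_val [NeZero t] {R : ℕ → ZMod 3} {F : ℕ → ZMod 3 → Prop} {i : ZMod t}
    {x : ZMod 3} (hfwd : F i.val x → i.val + 1 < t ∧ ¬ F (i.val + 1) (-x) ∧ -x ≠ R (i.val + 1))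
    (hbwd : ¬ F i.val x → x ≠ R i.val → i.val ≠ 0 ∧ F (i.val - 1) (-x)) :
    ringPartner (fun i => R i.val) (fun i => F i.val)
      (ringPartner (fun i => R i.val) (fun i => F i.val) (i, some x)) = (i, some x) := by
  refine ringPartner_ringPartner_leaf (fun h => ?_) (fun h hx => ?_)
  · obtain ⟨hlt, h⟩ := hfwd h
    rwa [val_add_one_of_lt hlt]
  · obtain ⟨h0, h⟩ := hbwd h hx
    rwa [val_sub_one_of_ne h0]

/-- The rows of the hub partners in `switchPartner`. -/
def switchRow (z : ZMod 3) (k : ℕ) : ZMod 3 := if k ≠ 0 ∧ Even k then -z else z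

/-- For odd `t`, the matching that joins the claw `2 * k + 1` to the claw `2 * k + 2` for every
`k`, and misses the two leaves of the claw `0` outside the row `z`. -/
noncomputable def switchPartner (t : ℕ) (z : ZMod 3) :
    ZMod t × Option (ZMod 3) → ZMod t × Option (ZMod 3) :=
  ringPartner (fun i => switchRow z i.val) fun i x => Odd i.val ∧ x ≠ switchRow z i.val

lemma switchPartner_switchPartner (hodd : Odd t) {z : ZMod 3} {v : ZMod t × Option (ZMod 3)}
    (hv : ∀ y ≠ z, v ≠ (0, some y)) : switchPartner t z (switchPartner t z v) = v := by
  have : NeZero t := ⟨by rintro rfl; simp at hodd⟩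
  obtain ⟨i, _ | x⟩ := v
  · exact ringPartner_ringPartner_hub fun h => h.2 rfl
  have hlt := i.val_lt
  refine ringPartner_ringPartner_val (R := switchRow z) (F := fun k x => Odd k ∧ x ≠ switchRow z k)
    ?_ ?_
  · rintro ⟨hk, hx⟩
    rw [switchRow, if_neg (by grind)] at hx
    rw [switchRow, if_pos (by grind)]
    grind
  · intro hf hx
    have hk : Even i.val := by grind
    have h0 : i.val ≠ 0 := fun h0 => by
      rw [ZMod.val_eq_zero] at h0
      subst h0
      exact hv x (by simpa [switchRow] using hx) rfl
    rw [switchRow, if_pos ⟨h0, hk⟩] at hx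
    rw [switchRow, if_neg (by grind)]
    grind

lemma switchPartner_zero {y z : ZMod 3} (h : y ≠ z) :
    switchPartner t z (0, some y) = (-1, some (-y)) := by
  rw [← zero_sub]
  exact ringPartner_backward (by simp) (by simpa [switchRow])

lemma val_neg_one_of_odd (hodd : Odd t) (ht : 3 ≤ t) :
    (-1 : ZMod t).val ≠ 0 ∧ Even (-1 : ZMod t).val := by
  obtain ⟨n, rfl⟩ := hodd
  rw [ZMod.val_neg_one]
  exact ⟨by omega, even_two_mul n⟩

lemma switchPartner_neg_one (hodd : Odd t) (ht : 3 ≤ t) {y z : ZMod 3} (h : y ≠ z) :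
    switchPartner t z (-1, some (-y)) = (-1 - 1, some y) := by
  have hval := val_neg_one_of_odd hodd ht
  rw [switchPartner, ringPartner_backward, neg_neg]
  · exact fun h' => Nat.not_odd_iff_even.2 hval.2 h'.1
  · rwa [switchRow, if_pos hval, Ne, neg_inj]

lemma isMatchingOn_switchPartner (hodd : Odd t) (ht : 3 ≤ t) (z : ZMod 3) :
    IsMatchingOn (flowerRing t) (switchPartner t z) {v | ∀ y ≠ z, v ≠ (0, some y)} := by
  have : Fact (1 < t) := ⟨by omega⟩
  refine fun v hv => ⟨adj_ringPartner v, fun y hy hvy => ?_, switchPartner_switchPartner hodd hv⟩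
  have h := switchPartner_switchPartner hodd hv
  rw [hvy, switchPartner_zero hy] at h
  rw [← h, switchPartner_neg_one hodd ht hy, Prod.mk.injEq, sub_eq_zero] at hvy
  have : Fact (2 < t) := ⟨ht⟩
  exact ZMod.neg_one_ne_one hvy.1

lemma unmatched_switchPartner_adj (hodd : Odd t) (ht : 3 ≤ t) {y z : ZMod 3} (h : y ≠ z) :
    (unmatched (flowerRing t) (switchPartner t z)).Adj (-1, none) (-1, some (-y)) := by
  have : Fact (1 < t) := ⟨by omega⟩
  have hhub : switchPartner t z (-1, none) = (-1, some (-z)) := by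
    rw [switchPartner, ringPartner_hub, switchRow, if_pos (val_neg_one_of_odd hodd ht)]
  refine ⟨flowerRing_adj_spoke _ _, ?_, ?_⟩
  · simpa [hhub] using h.symm
  · simp [switchPartner_neg_one hodd ht h]

lemma not_isGadgetPair_links_neg_one (hodd : Odd t) (ht : 3 ≤ t) {y y' : ZMod 3} (h : y ≠ y') :
    ¬ IsGadgetPair (flowerRing t) (-1, some (-y)) (0, some y) (-1, some (-y')) (0, some y') := by
  have hthird : ∀ y y' : ZMod 3, y ≠ y' → ∃ z, y ≠ z ∧ y' ≠ z ∧ ∀ x, x ≠ z ↔ x = y ∨ x = y' := by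
    decide
  obtain ⟨z, hy, hy', hz⟩ := hthird y y' h
  have hset : {v : ZMod t × Option (ZMod 3) | ∀ y ≠ z, v ≠ (0, some y)} =
      {(0, some y), (0, some y')}ᶜ := by
    ext v
    simp [hz]
  have hm := hset ▸ isMatchingOn_switchPartner hodd ht z
  have hcross : Disjoint (flowerRing t).edgeSet
      (crossEdges (-1, some (-y)) (0, some y) (-1, some (-y')) (0, some y')) := by
    have : Fact (1 < t) := ⟨by omega⟩
    simp [crossEdges, flowerRing, h, h.symm]
  intro hpair
  refine hpair.not_even_length_of_isMatchingOn_compl (isCubic_flowerRing ht) hcross hm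
    (switchPartner_zero hy) (switchPartner_zero hy')
    (p := .cons (unmatched_switchPartner_adj hodd ht hy').symm
      (.cons (unmatched_switchPartner_adj hodd ht hy) .nil)) ?_ even_two
  simpa using h.symm

lemma not_isGadgetPair_links (hodd : Odd t) (ht : 3 ≤ t) {x x' : ZMod 3} (h : x ≠ x')
    (i : ZMod t) :
    ¬ IsGadgetPair (flowerRing t) (ringEdge i (true, x)).1 (ringEdge i (true, x)).2
      (ringEdge i (true, x')).1 (ringEdge i (true, x')).2 := by
  intro hpair
  have := hpair.map (flowerRingRotation (-1 - i))
  have h0 : i + 1 + (-1 - i) = 0 := by ring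
  simp only [ringEdge, flowerRingRotation_apply, add_sub_cancel, h0] at this
  refine not_isGadgetPair_links_neg_one hodd ht (y := -x) (y' := -x') (by simpa) ?_
  rwa [neg_neg, neg_neg]

lemma not_isGadgetPair_ringEdge_of_le (hodd : Odd t) (ht : 3 ≤ t) {i i' : ZMod t}
    (hle : (i' - i).val + 3 ≤ t) (e e' : Bool × ZMod 3) :
    ¬ IsGadgetPair (flowerRing t) (ringEdge i e).1 (ringEdge i e).2
      (ringEdge i' e').1 (ringEdge i' e').2 := by
  intro h
  have : Fact (1 < t) := ⟨by omega⟩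
  have hi' : i' = i + ((i' - i).val : ZMod t) := by rw [ZMod.natCast_zmod_val, add_sub_cancel]
  have hind := h.independent
  have h0 (h0 : (i' - i).val = 0) : e.1 ≠ e'.1 ∧ e.2 ≠ e'.2 := by
    rw [h0, Nat.cast_zero, add_zero] at hi'
    subst hi'
    obtain ⟨_ | _, x⟩ := e <;> obtain ⟨_ | _, x'⟩ := e'
    case true.true =>
      refine absurd h (not_isGadgetPair_links hodd ht ?_ _)
      rintro rfl
      exact hind.1 rfl
    all_goals simp_all [ringEdge]
  have h1 (h1 : (i' - i).val = 1) : ¬ (e.1 = true ∧ e'.2 = -e.2) := by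
    rw [h1, Nat.cast_one] at hi'
    subst hi'
    rintro ⟨he, he'⟩
    obtain ⟨_ | _, x⟩ := e <;> obtain ⟨_ | _, x'⟩ := e' <;> simp_all [ringEdge]
  have key := not_isGadgetPair_ringEdge (isCubic_flowerRing ht) hle h0 h1 i
  rw [← hi'] at key
  exact key h

theorem not_isGadgetPair_flowerRing (hodd : Odd t) (ht : 5 ≤ t)
    (a b c d : ZMod t × Option (ZMod 3)) : ¬ IsGadgetPair (flowerRing t) a b c d := by
  intro h
  have : NeZero t := ⟨by omega⟩
  obtain ⟨i, e, hab⟩ := exists_ringEdge h.adj_left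
  obtain ⟨i', e', hcd⟩ := exists_ringEdge h.adj_right
  replace h : IsGadgetPair (flowerRing t) (ringEdge i e).1 (ringEdge i e).2
      (ringEdge i' e').1 (ringEdge i' e').2 := by
    rcases hab with hab | hab <;> rcases hcd with hcd | hcd <;> rw [hab, hcd]
    exacts [h, h.swap_right, h.swap_left, h.swap_left.swap_right]
  by_cases hle : (i' - i).val + 3 ≤ t
  · exact not_isGadgetPair_ringEdge_of_le hodd (by omega) hle e e' h
  · refine not_isGadgetPair_ringEdge_of_le hodd (by omega) ?_ e' e h.swap
    have : NeZero (i' - i) := ⟨fun h0 => by rw [h0, ZMod.val_zero] at hle; omega⟩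
    rw [← neg_sub i' i, ZMod.val_neg_of_ne_zero]
    omega

end RingGadgetPairs

section RingBoldEdges

variable {t : ℕ}

lemma unmatched_ringPartner_spoke {r : ZMod t → ZMod 3} {f : ZMod t → ZMod 3 → Prop} {i : ZMod t}
    {x : ZMod 3} (h : x ≠ r i) :
    (unmatched (flowerRing t) (ringPartner r f)).Adj (i, none) (i, some x) := by
  refine ⟨flowerRing_adj_spoke i x, by simpa [ringPartner_hub] using h.symm, ?_⟩
  by_cases hf : f i x
  · simp [ringPartner_forward hf]
  · simp [ringPartner_backward hf h]

lemma unmatched_ringPartner_link (ht : 3 ≤ t) {r : ZMod t → ZMod 3} {f : ZMod t → ZMod 3 → Prop}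
    {i : ZMod t} {x : ZMod 3} (h : ¬ f i x) (h' : f (i + 1) (-x)) :
    (unmatched (flowerRing t) (ringPartner r f)).Adj (i, some x) (i + 1, some (-x)) := by
  have : Fact (1 < t) := ⟨by omega⟩
  have : Fact (2 < t) := ⟨ht⟩
  have hne : (1 : ZMod t) ≠ -1 := ZMod.neg_one_ne_one.symm
  refine ⟨flowerRing_adj_link i x, ?_, ?_⟩
  · by_cases hx : x = r i
    · subst hx
      simp [ringPartner_spoke h]
    · simp [ringPartner_backward h hx, sub_eq_add_neg, hne.symm]
  · rw [ringPartner_forward h', add_assoc]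
    simp [← eq_neg_iff_add_eq_zero, hne]

/-- The rows of the hub partners in `deletionPartner`. -/
def deletionRow (x y z : ZMod 3) (k : ℕ) : ZMod 3 :=
  if k = 0 then y else if k = 1 then -x else if Even k then z else -z

/-- The leaves whose forward links belong to `deletionPartner`. -/
def DeletionLink (y z : ZMod 3) (k : ℕ) (w : ZMod 3) : Prop :=
  k = 0 ∧ w ≠ y ∨ k = 1 ∧ w = -y ∨ 3 ≤ k ∧ Odd k ∧ w ≠ -z

/-- A matching of the flower snark for odd `t` that misses exactly the leaf in row `-x` of the
claw `1` and its neighbours, where `x`, `y` and `z` are the three rows. -/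
noncomputable def deletionPartner (t : ℕ) (x y z : ZMod 3) :
    ZMod t × Option (ZMod 3) → ZMod t × Option (ZMod 3) :=
  ringPartner (fun i => deletionRow x y z i.val) fun i => DeletionLink y z i.val

lemma deletionPartner_deletionPartner (hodd : Odd t) (ht : 5 ≤ t) {x y z : ZMod 3}
    (h : ∀ w, w = x ∨ w = y ∨ w = z) (hxy : x ≠ y) (hyz : y ≠ z)
    {v : ZMod t × Option (ZMod 3)} (h0 : v ≠ (0, some x)) (h2 : v ≠ (2, some x)) :
    deletionPartner t x y z (deletionPartner t x y z v) = v := by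
  have : NeZero t := ⟨by omega⟩
  obtain ⟨i, _ | w⟩ := v
  · refine ringPartner_ringPartner_hub ?_
    simp only [DeletionLink, deletionRow]
    grind
  have hlt := i.val_lt
  have h0 : i.val = 0 → w ≠ x := by
    rintro hi rfl
    exact h0 (by rw [(ZMod.val_eq_zero i).1 hi])
  have h2 : i.val = 2 → w ≠ x := by
    rintro hi rfl
    exact h2 (by rw [← ZMod.natCast_zmod_val i, hi, Nat.cast_ofNat])
  have hw := h w
  clear h
  refine ringPartner_ringPartner_val (R := deletionRow x y z) (F := DeletionLink y z) ?_ ?_ <;>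
  · generalize i.val = k at *
    simp only [DeletionLink, deletionRow]
    grind

lemma deletionPartner_eq_of_adj (ht : 5 ≤ t) {x y z : ZMod 3} (hxy : x ≠ y) (hxz : x ≠ z)
    {v : ZMod t × Option (ZMod 3)} (h : (flowerRing t).Adj (1, some (-x)) v) :
    deletionPartner t x y z v = (1, some (-x)) := by
  have : Fact (1 < t) := ⟨by omega⟩
  have h0 : (0 : ZMod t).val = 0 := ZMod.val_zero
  have h1 : (1 : ZMod t).val = 1 := ZMod.val_one t
  have h2 : (2 : ZMod t).val = 2 := ZMod.val_ofNat_of_lt (show 2 < t by omega)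
  rw [flowerRing_adj_leaf_iff, neg_neg, sub_self, one_add_one_eq_two] at h
  rcases h with rfl | rfl | rfl
  · simp [deletionPartner, ringPartner_hub, deletionRow, h1]
  · rw [deletionPartner, ringPartner_backward]
    · norm_num
    · simp [DeletionLink, h2]
    · simpa [deletionRow, h2]
  · rw [deletionPartner, ringPartner_forward, zero_add]
    simp [DeletionLink, hxy]

lemma isMatchingOn_deletionPartner (hodd : Odd t) (ht : 5 ≤ t) {x y z : ZMod 3}
    (h : ∀ w, w = x ∨ w = y ∨ w = z) (hxy : x ≠ y) (hxz : x ≠ z) (hyz : y ≠ z) :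
    IsMatchingOn (flowerRing t) (deletionPartner t x y z)
      {v | v ≠ (1, some (-x)) ∧ ¬ (flowerRing t).Adj (1, some (-x)) v} := by
  have : Fact (1 < t) := ⟨by omega⟩
  rintro v ⟨hv, hvadj⟩
  have hinv : deletionPartner t x y z (deletionPartner t x y z v) = v := by
    refine deletionPartner_deletionPartner hodd ht h hxy hyz ?_ ?_ <;> rintro rfl <;>
      simp [flowerRing_adj_leaf_iff, one_add_one_eq_two] at hvadj
  refine ⟨adj_ringPartner v, ⟨fun hmv => hvadj ?_, fun hadj => hv ?_⟩, hinv⟩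
  · rw [← hmv]
    exact (adj_ringPartner v).symm
  · rw [← hinv, deletionPartner_eq_of_adj ht hxy hxz hadj]

lemma exists_isCycle_unmatched_deletionPartner (ht : 5 ≤ t) {x y z : ZMod 3} (hxy : x ≠ y)
    (hxz : x ≠ z) (hyz : y ≠ z) :
    ∃ p : (unmatched (flowerRing t) (deletionPartner t x y z)).Walk (2, none) (2, none),
      p.IsCycle ∧ Even p.length ∧ (1, some (-x)) ∉ p.support := by
  have h2 : (2 : ZMod t).val = 2 := ZMod.val_ofNat_of_lt (show 2 < t by omega)
  have h3 : (3 : ZMod t).val = 3 := ZMod.val_ofNat_of_lt (show 3 < t by omega)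
  have h21 : (2 : ZMod t) + 1 = 3 := by norm_num
  have hspoke (w) (hw : w ≠ z) : (unmatched (flowerRing t) (deletionPartner t x y z)).Adj
      (2, none) (2, some w) := unmatched_ringPartner_spoke (by simpa [deletionRow, h2])
  have hspoke' (w) (hw : w ≠ z) : (unmatched (flowerRing t) (deletionPartner t x y z)).Adj
      (3, none) (3, some (-w)) :=
    unmatched_ringPartner_spoke (by simpa [deletionRow, h3, show ¬ Even 3 by decide])
  have hlink (w) (hw : w ≠ z) : (unmatched (flowerRing t) (deletionPartner t x y z)).Adj
      (2, some w) (3, some (-w)) := by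
    rw [← h21]
    refine unmatched_ringPartner_link (by omega) (by simp [DeletionLink, h2]) (.inr (.inr ?_))
    rw [h21, h3]
    exact ⟨le_rfl, by decide, by simpa⟩
  have hne : (2 : ZMod t) ≠ 3 := fun h => by simpa [h2, h3] using congrArg ZMod.val h
  refine ⟨.cons (hspoke y hyz) (.cons (hlink y hyz) (.cons (hspoke' y hyz).symm
    (.cons (hspoke' x hxz) (.cons (hlink x hxz).symm (.cons (hspoke x hxz).symm .nil))))),
    isCycle_cons_of_isPath ?_ (by simp) _, ⟨3, rfl⟩, ?_⟩
  · simp [Walk.isPath_def, hne, hne.symm, hxy.symm]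
  · have h1 : (1 : ZMod t).val = 1 := ZMod.val_one'' (by omega)
    have h12 : (1 : ZMod t) ≠ 2 := fun h => by simpa [h1, h2] using congrArg ZMod.val h
    have h13 : (1 : ZMod t) ≠ 3 := fun h => by simpa [h1, h3] using congrArg ZMod.val h
    simp [h12, h13]

lemma not_isOddTwoFactored_flowerRing_induce (hodd : Odd t) (ht : 5 ≤ t) (i : ZMod t)
    (x : ZMod 3) : ¬ IsOddTwoFactored ((flowerRing t).induce {(i, some x)}ᶜ) := by
  intro h
  have hrot := h.of_iso (isoInduceCompl (flowerRingRotation (1 - i)) _)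
  rw [flowerRingRotation_apply, add_sub_cancel] at hrot
  have hrows : ∀ x : ZMod 3, ∃ y z, x ≠ y ∧ x ≠ z ∧ y ≠ z ∧ ∀ w, w = x ∨ w = y ∨ w = z := by
    decide
  obtain ⟨y, z, hxy, hxz, hyz, hrow⟩ := hrows (-x)
  obtain ⟨p, hp, heven, hmem⟩ := exists_isCycle_unmatched_deletionPartner ht hxy hxz hyz
  have hm := isMatchingOn_deletionPartner hodd ht hrow hxy hxz hyz
  have hadj := @deletionPartner_eq_of_adj t ht (-x) y z hxy hxz
  rw [neg_neg] at hm hmem hadj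
  exact (isCubic_flowerRing (by omega)).not_isOddTwoFactored_induce hm (fun _ => hadj) hp heven
    hmem hrot

theorem not_isBoldEdge_flowerRing (hodd : Odd t) (ht : 5 ≤ t) (v w : ZMod t × Option (ZMod 3)) :
    ¬ IsBoldEdge (flowerRing t) v w := by
  intro h
  match v, w with
  | (_, some _), _ => exact not_isOddTwoFactored_flowerRing_induce hodd ht _ _ h.odd_delete_left
  | _, (_, some _) => exact not_isOddTwoFactored_flowerRing_induce hodd ht _ _ h.odd_delete_right
  | (_, none), (_, none) => simpa [flowerRing] using h.adj

end RingBoldEdges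

section RingFlower

variable {t : ℕ}

/-- The ring coordinates of the vertices of the flower snark: the sign of the rows of `uᵢ` and `vᵢ`
alternates with `i`, since links of `flowerRing` change the sign. -/
def flowerCoord : FlowerVertex t → ZMod t × Option (ZMod 3)
  | .h i => (i.val, none)
  | .u i => (i.val, some ((-1) ^ i.val))
  | .v i => (i.val, some (-(-1) ^ i.val))
  | .w i => (i.val, some 0)

lemma natCast_val_inj {i j : Fin t} : (i.val : ZMod t) = j.val ↔ i = j := by
  rw [ZMod.natCast_eq_natCast_iff', Nat.mod_eq_of_lt i.isLt, Nat.mod_eq_of_lt j.isLt, Fin.ext_iff]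

lemma natCast_val_eq_add_one_iff (i j : Fin t) :
    (j.val : ZMod t) = i.val + 1 ↔ i.val + 1 = j.val ∨ i.val + 1 = t ∧ j.val = 0 := by
  rw [← Nat.cast_succ, ZMod.natCast_eq_natCast_iff', Nat.mod_eq_of_lt j.isLt]
  rcases (Nat.succ_le_of_lt i.isLt).lt_or_eq with h | h
  · rw [Nat.mod_eq_of_lt h]
    omega
  · rw [h, Nat.mod_self]
    omega

lemma flowerCoord_bijective (ht : 0 < t) : Function.Bijective (flowerCoord (t := t)) := by
  have : NeZero t := ⟨ht.ne'⟩
  have hsign (k : ℕ) : (-1 : ZMod 3) ^ k ≠ -(-1) ^ k ∧ (-1 : ZMod 3) ^ k ≠ 0 ∧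
      ∀ x : ZMod 3, x = (-1) ^ k ∨ x = -(-1) ^ k ∨ x = 0 := by
    rcases neg_one_pow_eq_or (ZMod 3) k with h | h <;> rw [h] <;> decide
  constructor
  · rintro (i | i | i | i) (j | j | j | j) h <;> simp only [flowerCoord, Prod.mk.injEq] at h <;>
      obtain rfl := natCast_val_inj.1 h.1 <;>
      simp_all [hsign i, (hsign i).1.symm, (hsign i).2.1.symm]
  · rintro ⟨i, x⟩
    have hi : i = (⟨i.val, i.val_lt⟩ : Fin t).val := (ZMod.natCast_zmod_val i).symm
    rw [hi]
    rcases x with _ | x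
    · exact ⟨.h _, rfl⟩
    rcases (hsign i.val).2.2 x with rfl | rfl | rfl
    exacts [⟨.u _, rfl⟩, ⟨.v _, rfl⟩, ⟨.w _, rfl⟩]

/-- `flowerCoord` is an isomorphism for odd `t`: the `t` sign changes around the ring then amount
to the twist in `J(t)`. -/
noncomputable def flowerIso (hodd : Odd t) : flower t ≃g flowerRing t where
  toEquiv := Equiv.ofBijective flowerCoord (flowerCoord_bijective hodd.pos)
  map_rel_iff' {p q} := by
    have hsign (k : ℕ) : (-1 : ZMod 3) ^ k = if Even k then 1 else -1 := by
      split_ifs with h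
      exacts [h.neg_one_pow, (Nat.not_even_iff_odd.1 h).neg_one_pow]
    have h3 : (1 : ZMod 3) ≠ -1 ∧ (1 : ZMod 3) ≠ 0 := by decide
    obtain i | i | i | i := p <;> obtain j | j | j | j := q <;>
      simp [flowerCoord, flower, flowerRing, natCast_val_eq_add_one_iff, natCast_val_inj, hsign,
        Fin.ext_iff] <;> grind

end RingFlower

section Cuts

variable {V W : Type*} {G : SimpleGraph V} {H : SimpleGraph W}

/-- The edges between `A` and its complement, oriented away from `A`. -/
def cutArcs (G : SimpleGraph V) (A : Set V) : Set (V × V) :=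
  {e | e.1 ∈ A ∧ e.2 ∉ A ∧ G.Adj e.1 e.2}

/-- `A` contains the vertices of a subgraph of minimum degree at least two. -/
def HasCore (G : SimpleGraph V) (A : Set V) : Prop :=
  ∃ C ⊆ A, C.Nonempty ∧ ∀ v ∈ C, (G.neighborSet v ∩ C).Nontrivial

/-- The variant of the cyclic edge-connectivity in which the two sides of an edge cut are only
required to contain subgraphs of minimum degree at least two. -/
noncomputable def coreConnectivity (G : SimpleGraph V) : ℕ∞ :=
  ⨅ (A : Set V) (_ : HasCore G A) (_ : HasCore G Aᶜ), (cutArcs G A).encard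

lemma encard_cutArcs_compl (A : Set V) : (cutArcs G Aᶜ).encard = (cutArcs G A).encard := by
  rw [← Set.encard_preimage_of_bijective Prod.swap_bijective]
  congr 1
  ext
  simp [cutArcs, adj_comm, and_left_comm]

lemma encard_cutArcs_preimage (φ : G ≃g H) (A : Set W) :
    (cutArcs G (φ ⁻¹' A)).encard = (cutArcs H A).encard := by
  rw [← Set.encard_preimage_of_bijective (φ.bijective.prodMap φ.bijective)]
  congr 1
  ext
  simp [cutArcs, φ.map_adj_iff]

lemma HasCore.mono {A B : Set V} (h : HasCore G A) (hAB : A ⊆ B) : HasCore G B := by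
  obtain ⟨C, hCA, hC⟩ := h
  exact ⟨C, hCA.trans hAB, hC⟩

lemma HasCore.preimage {A : Set W} (h : HasCore H A) (φ : G ≃g H) : HasCore G (φ ⁻¹' A) := by
  obtain ⟨C, hCA, hne, hC⟩ := h
  refine ⟨φ ⁻¹' C, Set.preimage_mono hCA, hne.preimage φ.surjective, fun v hv => ?_⟩
  have : G.neighborSet v ∩ φ ⁻¹' C = φ ⁻¹' (H.neighborSet (φ v) ∩ C) := by
    ext
    simp [φ.map_adj_iff]
  rw [this]
  exact (hC _ hv).preimage φ.surjective

lemma coreConnectivity_le_of_iso (φ : G ≃g H) : coreConnectivity G ≤ coreConnectivity H :=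
  le_iInf₂ fun A h => le_iInf fun h' => (iInf₂_le _ (h.preimage φ)).trans <|
    (iInf_le _ (h'.preimage φ)).trans (encard_cutArcs_preimage φ A).le

lemma hasCore_support {F : SimpleGraph V} (hF : F ≤ G) {u : V} {p : F.Walk u u} (hp : p.IsCycle) :
    HasCore G {v | v ∈ p.support} := by
  refine ⟨_, subset_rfl, ⟨u, p.start_mem_support⟩, fun v hv => ?_⟩
  have hnbr : (p.toSubgraph.neighborSet v).Nontrivial := by
    obtain ⟨w, w', hne, h⟩ := Set.ncard_eq_two.1 (hp.ncard_neighborSet_toSubgraph_eq_two hv)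
    rw [h]
    exact Set.nontrivial_pair hne
  exact hnbr.mono fun w hw => ⟨hF hw.adj_sub, p.mem_verts_toSubgraph.1 hw.snd_mem⟩

lemma coreConnectivity_le_cyclicEdgeConnectivity :
    coreConnectivity G ≤ cyclicEdgeConnectivity G := by
  classical
  refine le_iInf₂ fun S ⟨_, u, v, p, q, hp, hq, hne⟩ => ?_
  let A : Set V := {w | (G.deleteEdges S).Reachable u w}
  have hle : G.deleteEdges S ≤ G := deleteEdges_le S
  have hA : HasCore G A := (hasCore_support hle hp).mono fun w hw => ⟨p.takeUntil w hw⟩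
  have hA' : HasCore G Aᶜ := (hasCore_support hle hq).mono fun w hw h =>
    hne (h.trans ⟨(q.takeUntil w hw).reverse⟩)
  refine (iInf₂_le A hA).trans <| (iInf_le _ hA').trans <|
    Set.encard_le_encard_of_injOn (f := Sym2.mk.uncurry) ?_ ?_
  · rintro ⟨w, x⟩ ⟨hw, hx, hadj⟩
    by_contra hS'
    exact hx (hw.trans (Adj.reachable (deleteEdges_adj.2 ⟨hadj, hS'⟩)))
  · rintro ⟨w, x⟩ ⟨hw, -⟩ ⟨w', x'⟩ ⟨-, hx', -⟩ h
    rcases Sym2.eq_iff.1 h with ⟨rfl, rfl⟩ | ⟨rfl, rfl⟩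
    exacts [rfl, absurd hw hx']

end Cuts

lemma five_le_card_of_petersen_core (C : Finset (Fin 10)) (hne : C.Nonempty)
    (hC : ∀ v ∈ C, 1 < (C.filter (petersen.Adj v)).card) : 5 ≤ C.card := by
  decide +revert +kernel

lemma five_le_card_petersen_cut (A : Finset (Fin 10)) (hA : A.card = 5) :
    5 ≤ ((A ×ˢ Aᶜ).filter fun e => petersen.Adj e.1 e.2).card := by
  decide +revert +kernel

lemma HasCore.five_le_card_petersen {A : Finset (Fin 10)} (h : HasCore petersen A) :
    5 ≤ A.card := by
  obtain ⟨C, hCA, hne, hC⟩ := h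
  lift C to Finset (Fin 10) using C.toFinite
  refine (five_le_card_of_petersen_core C hne fun v hv => ?_).trans
    (Finset.card_le_card (Finset.coe_subset.1 hCA))
  have : petersen.neighborSet v ∩ C = ↑(C.filter (petersen.Adj v)) := by
    ext
    simp [and_comm]
  rw [Finset.one_lt_card_iff_nontrivial, ← Finset.nontrivial_coe, ← this]
  exact hC v hv

theorem five_le_coreConnectivity_petersen : 5 ≤ coreConnectivity petersen := by
  refine le_iInf₂ fun A h => le_iInf fun h' => ?_
  lift A to Finset (Fin 10) using A.toFinite
  have hA := h.five_le_card_petersen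
  rw [← Finset.coe_compl] at h'
  have hA' := h'.five_le_card_petersen
  rw [Finset.card_compl, Fintype.card_fin] at hA'
  have hcut : cutArcs petersen A = ↑((A ×ˢ Aᶜ).filter fun e => petersen.Adj e.1 e.2) := by
    ext
    simp [cutArcs, and_assoc]
  rw [hcut, Set.encard_coe_eq_coe_finsetCard]
  exact_mod_cast five_le_card_petersen_cut A (by omega)

section RingCuts

variable {t : ℕ}

/-- The `n`-th leaf on the walk along the links that starts in row `x` of the claw `0`. -/
def ringTrack (t : ℕ) (x : ZMod 3) (n : ℕ) : ZMod t × Option (ZMod 3) :=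
  (n, some ((-1) ^ n * x))

lemma ringTrack_adj_succ [Fact (1 < t)] (x : ZMod 3) (n : ℕ) :
    (flowerRing t).Adj (ringTrack t x n) (ringTrack t x (n + 1)) := by
  simpa [ringTrack, pow_succ] using flowerRing_adj_link (n : ZMod t) ((-1) ^ n * x)

lemma ringTrack_val [NeZero t] (i : ZMod t) (x : ZMod 3) :
    ringTrack t ((-1) ^ i.val * x) i.val = (i, some x) := by
  rw [ringTrack, ← mul_assoc, ← mul_pow, ZMod.natCast_zmod_val]
  simp

/-- A label that separates the arcs of a cut: the direction and the row in which the track of the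
link starts, or `none` for a spoke. -/
def arcLabel : (ZMod t × Option (ZMod 3)) × (ZMod t × Option (ZMod 3)) → Option (Bool × ZMod 3)
  | ((i, some x), (j, some y)) =>
    if j = i + 1 then some (true, (-1) ^ i.val * x) else some (false, (-1) ^ j.val * y)
  | _ => none

lemma arcLabel_ringTrack {x : ZMod 3} {n : ℕ} (hn : n < t) :
    arcLabel (ringTrack t x n, ringTrack t x (n + 1)) = some (true, x) := by
  simp [arcLabel, ringTrack, ZMod.val_cast_of_lt hn, ← mul_assoc, ← mul_pow]

lemma arcLabel_ringTrack_reverse (ht : 3 ≤ t) {x : ZMod 3} {n : ℕ} (hn : n < t) :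
    arcLabel (ringTrack t x (n + 1), ringTrack t x n) = some (false, x) := by
  have : Fact (2 < t) := ⟨ht⟩
  have h : (1 : ZMod t) + 1 ≠ 0 := by
    rw [Ne, ← eq_neg_iff_add_eq_zero]
    exact ZMod.neg_one_ne_one.symm
  simp [arcLabel, ringTrack, ZMod.val_cast_of_lt hn, ← mul_assoc, ← mul_pow, add_assoc, h]

lemma exists_not_and_succ {p : ℕ → Prop} {m n : ℕ} (hmn : m ≤ n) (hm : ¬ p m) (hn : p n) :
    ∃ k < n, ¬ p k ∧ p (k + 1) := by
  by_contra! h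
  have (k : ℕ) (hk : m ≤ k) : k ≤ n → ¬ p k := by
    induction k, hk using Nat.le_induction with
    | base => exact fun _ => hm
    | succ k _ ih => exact fun hkn => h k hkn (ih (by omega))
  exact this n hmn le_rfl hn

lemma mem_arcLabel_image (ht : 3 ≤ t) {A : Set (ZMod t × Option (ZMod 3))}
    (h0 : ∀ x, (0, x) ∈ A) {i : ZMod t} {x : ZMod 3} (hx : (i, some x) ∉ A) (b : Bool) :
    some (b, (-1) ^ i.val * x) ∈ arcLabel '' cutArcs (flowerRing t) A := by
  have : Fact (1 < t) := ⟨by omega⟩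
  have hlt := i.val_lt
  rw [← ringTrack_val i x] at hx
  generalize (-1) ^ i.val * x = y at *
  cases b with
  | true =>
    obtain ⟨n, hn, hA, hA'⟩ := exists_not_and_succ (p := fun n => ringTrack t y n ∉ A)
      i.val.zero_le (by simpa [ringTrack] using h0 _) hx
    exact ⟨_, ⟨not_not.1 hA, hA', ringTrack_adj_succ y n⟩, arcLabel_ringTrack (hn.trans hlt)⟩
  | false =>
    obtain ⟨n, hn, hA, hA'⟩ := exists_not_and_succ (p := fun n => ringTrack t y n ∈ A) hlt.le hx
      (by simpa [ringTrack] using h0 _)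
    exact ⟨_, ⟨hA', hA, (ringTrack_adj_succ y n).symm⟩, arcLabel_ringTrack_reverse ht hn⟩

lemma exists_claw_of_core [Fact (1 < t)] {C : Set (ZMod t × Option (ZMod 3))} (hne : C.Nonempty)
    (h0 : ∀ x, (0, x) ∉ C) (hC : ∀ v ∈ C, ((flowerRing t).neighborSet v ∩ C).Nontrivial) :
    ∃ i x y, x ≠ y ∧ (i, none) ∈ C ∧ (i, some x) ∈ C ∧ (i, some y) ∈ C := by
  have : NeZero t := ⟨by have := Fact.out (p := 1 < t); omega⟩
  obtain ⟨i, hi⟩ : ∃ i, (i, none) ∈ C := by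
    obtain ⟨⟨i, _ | x⟩, hv, hmin⟩ := exists_minimalFor_of_wellFoundedLT (· ∈ C) (·.1.val) hne
    · exact ⟨i, hv⟩
    by_contra! hhub
    have hprev : (i - 1, some (-x)) ∉ C := fun h => by
      have hi : i.val ≠ 0 := fun hi => h0 x (by rwa [(ZMod.val_eq_zero i).1 hi] at hv)
      have hpred := val_sub_one_of_ne hi
      have hle : i.val ≤ (i - 1).val := hmin h (by simp only; omega)
      omega
    have heq : ∀ w ∈ (flowerRing t).neighborSet (i, some x) ∩ C, w = (i + 1, some (-x)) := by
      rintro w ⟨hw, hwC⟩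
      rcases (flowerRing_adj_leaf_iff i x w).1 hw with rfl | rfl | rfl
      exacts [absurd hwC (hhub i), rfl, absurd hwC hprev]
    obtain ⟨w, hw, w', hw', hww'⟩ := hC _ hv
    exact hww' ((heq w hw).trans (heq w' hw').symm)
  have hleaf : ∀ w, (flowerRing t).Adj (i, none) w → ∃ x, w = (i, some x) := by
    rintro ⟨j, _ | x⟩ <;> simp [flowerRing, eq_comm]
  obtain ⟨w, ⟨hw, hwC⟩, w', ⟨hw', hwC'⟩, hne⟩ := hC _ hi
  obtain ⟨x, rfl⟩ := hleaf w hw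
  obtain ⟨y, rfl⟩ := hleaf w' hw'
  exact ⟨i, x, y, by rintro rfl; exact hne rfl, hi, hwC, hwC'⟩

lemma five_le_encard_cutArcs_of_claw (ht : 3 ≤ t) {A : Set (ZMod t × Option (ZMod 3))}
    (h0 : ∀ x, (0, x) ∈ A) (hA : HasCore (flowerRing t) Aᶜ) :
    5 ≤ (cutArcs (flowerRing t) A).encard := by
  have : Fact (1 < t) := ⟨by omega⟩
  obtain ⟨C, hCA, hne, hC⟩ := hA
  obtain ⟨i, x, y, hxy, hhub, hx, hy⟩ := exists_claw_of_core hne (fun x h => hCA h (h0 x)) hC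
  have hthird : ∀ x y : ZMod 3, x ≠ y → ∃ z, x ≠ z ∧ y ≠ z := by decide
  obtain ⟨z, hxz, hyz⟩ := hthird x y hxy
  have hmem (w : ZMod 3) (hw : (i, some w) ∉ A) := mem_arcLabel_image ht h0 hw
  obtain ⟨l, hl, hlmem⟩ : ∃ l, (l = none ∨ l = some (true, (-1) ^ i.val * z)) ∧
      l ∈ arcLabel '' cutArcs (flowerRing t) A := by
    by_cases hz : (i, some z) ∈ A
    · exact ⟨none, .inl rfl, ((i, some z), (i, none)),
        ⟨hz, hCA hhub, (flowerRing_adj_spoke i z).symm⟩, rfl⟩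
    · exact ⟨_, .inr rfl, hmem z hz true⟩
  have hinj : Function.Injective fun w : ZMod 3 => (-1) ^ i.val * w :=
    (isUnit_one.neg.pow _).mul_right_injective
  have hlabels : ∀ x y z : ZMod 3, x ≠ y → x ≠ z → y ≠ z → ∀ l, l = none ∨ l = some (true, z) →
      ({some (true, x), some (false, x), some (true, y), some (false, y), l} :
        Finset (Option (Bool × ZMod 3))).card = 5 := by decide
  rw [show (5 : ℕ∞) = (5 : ℕ) from rfl,
    ← hlabels _ _ _ (hinj.ne hxy) (hinj.ne hxz) (hinj.ne hyz) l hl,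
    ← Set.encard_coe_eq_coe_finsetCard]
  refine (Set.encard_le_encard ?_).trans (Set.encard_image_le arcLabel _)
  simp only [Finset.coe_insert, Finset.coe_singleton, Set.insert_subset_iff,
    Set.singleton_subset_iff]
  exact ⟨hmem x (hCA hx) true, hmem x (hCA hx) false, hmem y (hCA hy) true, hmem y (hCA hy) false,
    hlmem⟩

theorem five_le_coreConnectivity_flowerRing (ht : 5 ≤ t) :
    5 ≤ coreConnectivity (flowerRing t) := by
  have hclaw {A : Set (ZMod t × Option (ZMod 3))} {i : ZMod t} (hi : ∀ x, (i, x) ∈ A)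
      (hA : HasCore (flowerRing t) Aᶜ) : 5 ≤ (cutArcs (flowerRing t) A).encard := by
    rw [← encard_cutArcs_preimage (flowerRingRotation i)]
    refine five_le_encard_cutArcs_of_claw (by omega) (fun x => ?_)
      (hA.preimage (flowerRingRotation i))
    rw [Set.mem_preimage, flowerRingRotation_apply, zero_add]
    exact hi x
  refine le_iInf₂ fun A hA => le_iInf fun hA' => ?_
  by_cases hfull : ∃ i, ∀ x, (i, x) ∈ A
  · exact hclaw hfull.choose_spec hA'
  by_cases hempty : ∃ i, ∀ x, (i, x) ∈ Aᶜ
  · rw [← encard_cutArcs_compl]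
    exact hclaw hempty.choose_spec (by rwa [compl_compl])
  push Not at hfull hempty
  have himage : (fun e => e.1.1) '' cutArcs (flowerRing t) A = Set.univ := by
    refine Set.eq_univ_of_forall fun i => ?_
    by_cases hhub : (i, none) ∈ A
    · obtain ⟨_ | x, hx⟩ := hfull i
      exacts [absurd hhub hx, ⟨(_, _), ⟨hhub, hx, flowerRing_adj_spoke i x⟩, rfl⟩]
    · obtain ⟨_ | x, hx⟩ := hempty i
      exacts [absurd (not_not.1 hx) hhub,
        ⟨(_, _), ⟨not_not.1 hx, hhub, (flowerRing_adj_spoke i x).symm⟩, rfl⟩]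
  have hcard := Set.encard_image_le (fun e => e.1.1) (cutArcs (flowerRing t) A)
  have : NeZero t := ⟨by omega⟩
  rw [himage, Set.encard_univ, ENat.card_eq_coe_natCard, Nat.card_zmod] at hcard
  exact (Nat.cast_le.2 ht).trans hcard

end RingCuts

lemma GadgetDotsIso.nonempty_iso {V W : Type u} {V' W' X : Type v} {L : SimpleGraph V}
    {R : SimpleGraph W} {L' : SimpleGraph V'} {R' : SimpleGraph W'} {H : SimpleGraph X}
    {x y r s t u : V} {a b c d : W} (φ : L ≃g L') (ψ : R ≃g R') (hg : IsGadgetPair R a b c d)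
    (h : GadgetDotsIso L' (φ x) (φ y) (φ r) (φ s) (φ t) (φ u) R' H) :
    Nonempty (snarkDotProduct L x y r s t u R a b c d ≃g H) :=
  (h _ _ _ _ (hg.map ψ)).map (snarkDotProductIso φ ψ x y r s t u a b c d).trans

theorem BoldGadgetConstructible.classification {V : Type u} {G : SimpleGraph V}
    (h : BoldGadgetConstructible G) :
    Nonempty (G ≃g BoldGadget.petersen) ∨
      (∃ t, 5 ≤ t ∧ Odd t ∧ Nonempty (G ≃g BoldGadget.flower t)) ∨
      Nonempty (G ≃g P18) ∨ Nonempty (G ≃g P26) ∨ Nonempty (G ≃g P34) := by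
  induction h with
  | petersen G e => exact .inl ⟨e⟩
  | flower G t ht hodd e => exact .inr (.inl ⟨t, ht, hodd, ⟨e⟩⟩)
  | dot L R G x y r s t u a b c d _ _ _ _ bold gadget hx hy e ihL ihR =>
    obtain ⟨ψ⟩ : Nonempty (R ≃g BoldGadget.petersen) := by
      rcases ihR with h | ⟨t, ht, hodd, ⟨φ⟩⟩ | ⟨⟨φ⟩⟩ | ⟨⟨φ⟩⟩ | ⟨⟨φ⟩⟩
      · exact h
      · exact (not_isGadgetPair_flowerRing hodd ht _ _ _ _
          (gadget.map (φ.trans (flowerIso hodd)))).elim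
      · exact (not_isGadgetPair_P18 _ _ _ _ (gadget.map φ)).elim
      · exact (not_isGadgetPair_P26 _ _ _ _ (gadget.map φ)).elim
      · exact (not_isGadgetPair_P34 _ _ _ _ (gadget.map φ)).elim
    rcases ihL with ⟨⟨φ⟩⟩ | ⟨t, ht, hodd, ⟨φ⟩⟩ | ⟨⟨φ⟩⟩ | ⟨⟨φ⟩⟩ | ⟨⟨φ⟩⟩
    · have hiso := gadgetDotsIso_petersen (φ.map_adj_iff.2 bold.adj)
        (image_neighborSet_sdiff φ hx) (image_neighborSet_sdiff φ hy)
      exact .inr (.inr (.inl ((hiso.nonempty_iso φ ψ gadget).map e.trans)))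
    · exact (not_isBoldEdge_flowerRing hodd ht _ _ (bold.map (φ.trans (flowerIso hodd)))).elim
    · have hiso := (bold.map φ).gadgetDotsIso_P18 (image_neighborSet_sdiff φ hx)
        (image_neighborSet_sdiff φ hy)
      exact .inr (.inr (.inr (.inl ((hiso.nonempty_iso φ ψ gadget).map e.trans))))
    · have hiso := (bold.map φ).gadgetDotsIso_P26 (image_neighborSet_sdiff φ hx)
        (image_neighborSet_sdiff φ hy)
      exact .inr (.inr (.inr (.inr ((hiso.nonempty_iso φ ψ gadget).map e.trans))))
    · exact (not_isBoldEdge_P34 _ _ (bold.map φ)).elim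

end BoldGadget

theorem theorem5p3_general {V : Type*} {G : SimpleGraph V}
    (hcyc : BoldGadget.cyclicEdgeConnectivity G < 5)
    (hconstr : BoldGadget.BoldGadgetConstructible G) :
    Nonempty (G ≃g BoldGadget.P18) ∨ Nonempty (G ≃g BoldGadget.P26) ∨
      Nonempty (G ≃g BoldGadget.P34) := by
  have hcore : BoldGadget.coreConnectivity G < 5 :=
    BoldGadget.coreConnectivity_le_cyclicEdgeConnectivity.trans_lt hcyc
  rcases hconstr.classification with ⟨⟨φ⟩⟩ | ⟨t, ht, hodd, ⟨φ⟩⟩ | h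
  · exact absurd (BoldGadget.five_le_coreConnectivity_petersen.trans
      (BoldGadget.coreConnectivity_le_of_iso φ.symm)) hcore.not_ge
  · exact absurd ((BoldGadget.five_le_coreConnectivity_flowerRing ht).trans
      (BoldGadget.coreConnectivity_le_of_iso (φ.trans (BoldGadget.flowerIso hodd)).symm))
      hcore.not_ge
  · exact h

theorem theorem5p3 {V : Type*} [Finite V] (G : SimpleGraph V)
    (hsnark : BoldGadget.IsSnark G)
    (hodd : BoldGadget.IsOddTwoFactored G)
    (hcyc : BoldGadget.cyclicEdgeConnectivity G = 4)
    (hconstr : BoldGadget.BoldGadgetConstructible G) :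
    Nonempty (G ≃g BoldGadget.P18) ∨ Nonempty (G ≃g BoldGadget.P26) ∨
      Nonempty (G ≃g BoldGadget.P34) :=
  theorem5p3_general (hcyc.trans_lt (by norm_num)) hconstr
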